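/- Let $A=F(X)$ and $B=F(Y)$ be free groups with finite bases $X$ and $Y$, let $C$ be a finitely generated group with monomorphisms $\varphi\colon C\to A$ and $\psi\colon C\to B$, and let $G=A*_C B$ be the corresponding amalgamated product, with $A$, $B$, $C$ identified with their images in $G$. Write $H^g=g^{-1}Hg$ and $h^g=g^{-1}hg$. Put $N^*_G(C)=\{g\in G : C\cap C^g\neq 1\}$ and $Z_G(C)=\bigcup_{g\in N^*_G(C)\smallsetminus C}\{h\in C : h^g\in C\}$. An element of $G$ is called *regular* if it does not lie in $(N^*_G(C)\smallsetminus C)\cup Z_G(C)$. A *reduced form* of $g\in G$ is an expression $g=cg_1\cdots g_n$ with $n\ge 0$, $c\in C$, $g_i\in(A\cup B)\smallsetminus C$, and consecutive $g_i$ in different factors; $g$ is *cyclically reduced* if it has a reduced form such that $n=0$, or $n=1$ and $g$ is not conjugate in $G$ to an element of $C$, or $n\ge 2$ and $g_1$, $g_n$ lie in different factors. Let $CR\subseteq G$ be the set of all conjugates of cyclically reduced regular elements. Then the conjugacy search problem in $G$ is decidable for all pairs in $CR\times G$. That is, there is a partial algorithm which takes as input pairs $(u,v)$ of words in the alphabet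 $(X\cup Y)^{\pm1}$ and has the following properties: 1. Whenever it halts on $(u,v)$, its output is correct: it either states that $u$ and $v$ are not conjugate in $G$, and they are not, or it returns a word $z$ with $z^{-1}uz=v$ in $G$. 2. It halts on every pair $(u,v)$ such that $u$ represents an element of $CR$. -/

import Mathlib

universe u v

section GeneralizedNormalizer

variable {G : Type u} [Group G]

/-- The conjugate `H ^ g = g⁻¹ H g`. -/
def conjSubgroup (H : Subgroup G) (g : G) : Subgroup G :=
  H.map (MulAut.conj g⁻¹).toMonoidHom

/-- The generalized normalizer `N*_G(H) = {g | H ∩ H ^ g ≠ 1}`. -/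
def genNormalizer (H : Subgroup G) : Set G :=
  {g | H ⊓ conjSubgroup H g ≠ ⊥}

/-- `Z_g(H) = {h ∈ H | h ^ g ∈ H}`, where `h ^ g = g⁻¹ h g`. -/
def zAt (H : Subgroup G) (g : G) : Set G :=
  {h | h ∈ H ∧ g⁻¹ * h * g ∈ H}

/-- `Z_G(H)`, the union of the sets `Z_g(H)` over all `g ∈ N*_G(H) \ H`. -/
def zSet (H : Subgroup G) : Set G :=
  ⋃ g ∈ genNormalizer H \ (H : Set G), zAt H g

/-- The black hole `(N*_G(H) \ H) ∪ Z_G(H)`; its elements are called singular. -/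
def blackHole (H : Subgroup G) : Set G :=
  (genNormalizer H \ (H : Set G)) ∪ zSet H

/-- An element is regular (with respect to `H`) if it is not in the black hole. -/
def IsRegularElt (H : Subgroup G) (g : G) : Prop :=
  g ∉ blackHole H

end GeneralizedNormalizer

section Amalgam

/-- The family consisting of the two factors `A` (index `false`) and `B` (index `true`). -/
def Factor (A B : Type u) : Bool → Type u
  | false => A
  | true => B

instance instGroupFactor (A B : Type u) [Group A] [Group B] : ∀ i, Group (Factor A B i)
  | false => (inferInstance : Group A)
  | true => (inferInstance : Group B)

variable {A B : Type u} {C : Type v} [Group A] [Group B] [Group C]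

/-- The two maps `φ : C → A` and `ψ : C → B` as one family. -/
def factorHom (φ : C →* A) (ψ : C →* B) : ∀ i, C →* Factor A B i
  | false => φ
  | true => ψ

/-- The amalgamated product `A *_C B` with respect to `φ : C → A` and `ψ : C → B`. -/
abbrev Amalgam (φ : C →* A) (ψ : C →* B) : Type (max u v) :=
  Monoid.PushoutI (factorHom φ ψ)

namespace Amalgam

variable (φ : C →* A) (ψ : C →* B)

/-- The canonical map `A → A *_C B`. -/
def inl : A →* Amalgam φ ψ :=
  Monoid.PushoutI.of (φ := factorHom φ ψ) false

/-- The canonical map `B → A *_C B`. -/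
def inr : B →* Amalgam φ ψ :=
  Monoid.PushoutI.of (φ := factorHom φ ψ) true

/-- The amalgamated subgroup `C` of `A *_C B`. -/
def amalgamated : Subgroup (Amalgam φ ψ) :=
  (Monoid.PushoutI.base (factorHom φ ψ)).range

/-- `g = c g₁ ⋯ gₙ` is a reduced form: `c ∈ C`, every `gᵢ` lies in `(A ∪ B) \ C`, and consecutive
`gᵢ` lie in different factors. (The word `w = g₁ ⋯ gₙ` is a list of elements of the factors, each
tagged with its factor; the last condition is a field of `Monoid.CoprodI.Word`.) -/
def IsReducedForm (g : Amalgam φ ψ) (c : C) (w : Monoid.CoprodI.Word (Factor A B)) : Prop :=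
  Monoid.PushoutI.Reduced (factorHom φ ψ) w ∧
    g = Monoid.PushoutI.base (factorHom φ ψ) c * Monoid.PushoutI.ofCoprodI w.prod

/-- `g` has a reduced form `c g₁ ⋯ gₙ` such that `n = 0`, or `n = 1` and `g` is not conjugate to
an element of `C`, or `n ≥ 2` and `g₁`, `gₙ` lie in different factors. -/
def IsCyclicallyReduced (g : Amalgam φ ψ) : Prop :=
  ∃ (c : C) (w : Monoid.CoprodI.Word (Factor A B)), IsReducedForm φ ψ g c w ∧
    (w.toList.length = 0 ∨
      (w.toList.length = 1 ∧ ∀ x ∈ amalgamated φ ψ, ¬ IsConj g x) ∨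
      (2 ≤ w.toList.length ∧
        ∃ a ∈ w.toList.head?, ∃ b ∈ w.toList.getLast?, a.1 ≠ b.1))

/-- The set `CR` of all conjugates of cyclically reduced regular elements of `A *_C B`. -/
def CR : Set (Amalgam φ ψ) :=
  {g | ∃ g₀, IsCyclicallyReduced φ ψ g₀ ∧ IsRegularElt (amalgamated φ ψ) g₀ ∧ IsConj g₀ g}

end Amalgam

end Amalgam

section SearchProblem

/-- Words over the alphabet `X ∪ X⁻¹`; the letter `(x, true)` is `x` and `(x, false)` is `x⁻¹`. -/
abbrev GroupWord (X : Type u) : Type u := List (X × Bool)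

/-- The element of `G` represented by a word, when the letter `x` stands for `γ x`. -/
def GroupWord.eval {X : Type u} {G : Type v} [Group G] (γ : X → G) (w : GroupWord X) : G :=
  FreeGroup.lift γ (FreeGroup.mk w)

/-- The correct answers to "are `u` and `v` conjugate, and if so, by which element?": `none` means
that they are not conjugate, and `some z` that `z` is a word with `z⁻¹ u z = v`. -/
def IsConjSearchAnswer {X : Type u} {G : Type v} [Group G] (γ : X → G) (u v : GroupWord X) :
    Option (GroupWord X) → Prop
  | none => ¬ IsConj (u.eval γ) (v.eval γ)
  | some z => (z.eval γ)⁻¹ * u.eval γ * z.eval γ = v.eval γ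

/-- The conjugacy search problem in `G` is decidable on the set of pairs `Φ`: there is a partial
algorithm, whose inputs are pairs of words, which gives a correct answer whenever it halts, and
which halts on every pair of words that represents a pair in `Φ`. -/
def ConjSearchDecidableOn {X : Type u} [Primcodable X] {G : Type v} [Group G] (γ : X → G)
    (Φ : Set (G × G)) : Prop :=
  ∃ f : GroupWord X × GroupWord X →. Option (GroupWord X), Partrec f ∧
    (∀ u v, ∀ r ∈ f (u, v), IsConjSearchAnswer γ u v r) ∧
    (∀ u v, (u.eval γ, v.eval γ) ∈ Φ → (f (u, v)).Dom)

/-- The standard generators `X ∪ Y` of `A *_C B`, where `A = F(X)` and `B = F(Y)`. -/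
def Amalgam.gen {X Y : Type u} {C : Type v} [Group C] (φ : C →* FreeGroup X)
    (ψ : C →* FreeGroup Y) : X ⊕ Y → Amalgam φ ψ :=
  Sum.elim (fun x => Amalgam.inl φ ψ (FreeGroup.of x)) (fun y => Amalgam.inr φ ψ (FreeGroup.of y))

end SearchProblem

/-!
Conjugators can be found by enumeration, so the point is to certify non-conjugacy. Let `u` be
regular and cyclically reduced, and let `v` be a cyclically reduced conjugate of `u`. Then some
conjugator from `u` to `v` has computably bounded word length, so that a finite search decides.

If `u` lies in a factor, then by regularity no conjugator moves a nontrivial `u` from one factor to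
the other, and the problem reduces to conjugacy in a free group. If `u` has at least two syllables,
then, up to a cyclic permutation of the syllables of `v`, the conjugator lies in `C`. As `C` is
quasiconvex in both factors, the path from `1` to the conjugator inside `C` stays close to its
translate by `u`. If the conjugator were longer than twice the number of elements of a suitable
ball, then by the pigeonhole principle two of the differences between the path and its translate
would agree. This yields a nontrivial element of `C ∩ C ^ u`, and by the same argument a short one,
contradicting regularity.

So regularity enters only through the elements of a ball of computable radius, where it can be
tested.
-/

open Monoid

section Syllables

variable {ι : Type*} {M : ι → Type*}

/-- A list of elements of the groups `M i`, each tagged with its index: the word `g₁ ⋯ gₙ` of a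
form `c g₁ ⋯ gₙ` in the amalgamated product of the `M i`. -/
abbrev Syllables (M : ι → Type*) := List (Σ i, M i)

namespace Syllables

/-- The sequence of factors in which the syllables lie. -/
def indices (l : Syllables M) : List ι := l.map Sigma.fst

@[simp] lemma indices_nil : indices ([] : Syllables M) = [] := rfl

@[simp] lemma indices_cons (s : Σ i, M i) (l : Syllables M) :
    indices (s :: l) = s.1 :: indices l := rfl

@[simp] lemma indices_append (l l' : Syllables M) :
    indices (l ++ l') = indices l ++ indices l' := List.map_append

@[simp] lemma length_indices (l : Syllables M) : (indices l).length = l.length := List.length_map _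

@[simp] lemma indices_eq_nil {l : Syllables M} : indices l = [] ↔ l = [] := List.map_eq_nil_iff

end Syllables

variable [∀ i, Group (M i)] {H : Type*} [Group H] {θ : ∀ i, H →* M i}

namespace Syllables

/-- The product of the syllables in the amalgamated product. -/
def prod (θ : ∀ i, H →* M i) (l : Syllables M) : PushoutI θ :=
  (l.map fun s => PushoutI.of s.1 s.2).prod

/-- The inverses of the syllables, in reverse order. -/
def inv (l : Syllables M) : Syllables M := (l.map fun s => ⟨s.1, s.2⁻¹⟩ : Syllables M).reverse

/-- No syllable lies in the amalgamated subgroup, and adjacent syllables lie in different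
factors. -/
structure IsReduced (θ : ∀ i, H →* M i) (l : Syllables M) : Prop where
  notMem_range : ∀ s ∈ l, s.2 ∉ (θ s.1).range
  isChain_indices : l.indices.IsChain (· ≠ ·)

@[simp] lemma indices_inv (l : Syllables M) : indices (inv l) = (indices l).reverse := by
  simp [indices, inv, Function.comp_def]

@[simp] lemma inv_inv (l : Syllables M) : inv (inv l) = l := by
  simp [inv, Function.comp_def]

@[simp] lemma prod_nil : prod θ ([] : Syllables M) = 1 := rfl

@[simp] lemma prod_cons (s : Σ i, M i) (l : Syllables M) :
    prod θ (s :: l) = PushoutI.of s.1 s.2 * prod θ l := List.prod_cons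

@[simp] lemma prod_append (l l' : Syllables M) : prod θ (l ++ l') = prod θ l * prod θ l' := by
  simp [prod]

@[simp] lemma prod_inv (l : Syllables M) : prod θ (inv l) = (prod θ l)⁻¹ := by
  simp [prod, inv, List.prod_inv_reverse, Function.comp_def]

lemma isReduced_nil : IsReduced θ ([] : Syllables M) := ⟨by simp, List.isChain_nil⟩

lemma isReduced_singleton {i : ι} {g : M i} (h : g ∉ (θ i).range) :
    IsReduced θ ([⟨i, g⟩] : Syllables M) := ⟨by simpa using h, List.isChain_singleton _⟩

lemma IsReduced.inv {l : Syllables M} (h : IsReduced θ l) : IsReduced θ l.inv where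
  notMem_range s hs := by
    obtain ⟨t, ht, rfl⟩ : ∃ t ∈ l, (⟨t.1, t.2⁻¹⟩ : Σ i, M i) = s := by
      simpa only [Syllables.inv, List.mem_reverse, List.mem_map] using hs
    simpa using h.notMem_range t ht
  isChain_indices := by
    rw [indices_inv, List.isChain_reverse]
    simpa only [ne_comm] using h.isChain_indices

lemma isReduced_append_iff {l l' : Syllables M} : IsReduced θ (l ++ l') ↔
    (IsReduced θ l ∧ IsReduced θ l') ∧
      ∀ x ∈ l.indices.getLast?, ∀ y ∈ l'.indices.head?, x ≠ y := by
  constructor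
  · rintro ⟨hmem, hchain⟩
    rw [indices_append, List.isChain_append] at hchain
    simp only [List.mem_append] at hmem
    exact ⟨⟨⟨fun s hs => hmem s (.inl hs), hchain.1⟩, fun s hs => hmem s (.inr hs), hchain.2.1⟩,
      hchain.2.2⟩
  · rintro ⟨⟨hl, hl'⟩, hne⟩
    refine ⟨fun s hs => (List.mem_append.1 hs).elim (hl.1 s) (hl'.1 s), ?_⟩
    rw [indices_append, List.isChain_append]
    exact ⟨hl.2, hl'.2, hne⟩

lemma isReduced_cons_iff {i : ι} {g : M i} {l : Syllables M} : IsReduced θ (⟨i, g⟩ :: l) ↔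
    g ∉ (θ i).range ∧ IsReduced θ l ∧ ∀ j ∈ l.indices.head?, i ≠ j := by
  rw [← List.singleton_append, isReduced_append_iff]
  constructor
  · rintro ⟨⟨hg, hl⟩, hne⟩
    exact ⟨hg.1 ⟨i, g⟩ (by simp), hl, fun j hj => hne i (by simp) j hj⟩
  · rintro ⟨hg, hl, hne⟩
    exact ⟨⟨isReduced_singleton hg, hl⟩, by simpa using hne⟩

lemma base_mul_of {i : ι} (c : H) (g : M i) :
    PushoutI.base θ c * PushoutI.of i g = PushoutI.of i (θ i c * g) := by
  rw [map_mul, PushoutI.of_apply_eq_base]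

lemma of_mem_base_range (hθ : ∀ i, Function.Injective (θ i)) {i : ι} {g : M i} :
    PushoutI.of i g ∈ (PushoutI.base θ).range ↔ g ∈ (θ i).range := by
  constructor
  · rintro ⟨c, hc⟩
    exact ⟨c, PushoutI.of_injective hθ i (by rw [PushoutI.of_apply_eq_base, hc])⟩
  · rintro ⟨c, rfl⟩
    exact ⟨c, (PushoutI.of_apply_eq_base θ i c).symm⟩

lemma base_mem_of_range (i : ι) (c : H) :
    PushoutI.base θ c ∈ (PushoutI.of (φ := θ) i).range :=
  ⟨θ i c, PushoutI.of_apply_eq_base θ i c⟩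

lemma IsReduced.exists_base_mul {l : Syllables M} (h : IsReduced θ l) (c : H) :
    ∃ (l' : Syllables M) (c' : H), IsReduced θ l' ∧ l'.indices = l.indices ∧
      PushoutI.base θ c * prod θ l = prod θ l' * PushoutI.base θ c' := by
  rcases l with _ | ⟨⟨i, g⟩, t⟩
  · exact ⟨[], c, isReduced_nil, rfl, by simp⟩
  · refine ⟨⟨i, θ i c * g⟩ :: t, 1, ?_, rfl, by simp [← mul_assoc, base_mul_of]⟩
    rw [isReduced_cons_iff] at h ⊢
    rw [Subgroup.mul_mem_cancel_left _ (MonoidHom.mem_range.2 ⟨c, rfl⟩)]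
    exact h

lemma IsReduced.exists_mul_base {l : Syllables M} (h : IsReduced θ l) (c : H) :
    ∃ (l' : Syllables M) (c' : H), IsReduced θ l' ∧ l'.indices = l.indices ∧
      prod θ l * PushoutI.base θ c = PushoutI.base θ c' * prod θ l' := by
  obtain ⟨l', c', hl', hind, heq⟩ := h.inv.exists_base_mul c⁻¹
  refine ⟨Syllables.inv l', c'⁻¹, hl'.inv, by simp [hind], ?_⟩
  simpa using congrArg (·⁻¹) heq

lemma exists_reduced_form (hθ : ∀ i, Function.Injective (θ i)) (g : PushoutI θ) :
    ∃ (c : H) (l : Syllables M), IsReduced θ l ∧ g = PushoutI.base θ c * prod θ l := by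
  classical
  obtain ⟨d⟩ := PushoutI.NormalWord.transversal_nonempty θ hθ
  obtain ⟨w, rfl⟩ := (PushoutI.NormalWord.equiv (d := d)).symm.surjective g
  have hmem : ∀ s ∈ w.toList, s.2 ∉ (θ s.1).range := by
    rintro ⟨i, x⟩ hs hx
    have huniq := (d.compl i).1 (a₁ := (⟨x, hx⟩, ⟨1, d.one_mem i⟩))
      (a₂ := (1, ⟨x, w.normalized i x hs⟩)) (by simp)
    exact w.ne_one _ hs (congrArg (fun p => (p.2 : M i)) huniq).symm
  refine ⟨w.head, w.toList, ⟨hmem, by simpa [indices, List.isChain_map] using w.chain_ne⟩, ?_⟩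
  change PushoutI.base θ w.head * PushoutI.ofCoprodI w.toWord.prod = _
  simp [CoprodI.Word.prod, prod, map_list_prod, Function.comp_def]

lemma IsReduced.exists_normalWord (d : PushoutI.NormalWord.Transversal θ) {l : Syllables M}
    (hl : IsReduced θ l) (a b : H) : ∃ w : PushoutI.NormalWord d,
      w.prod = PushoutI.base θ a * prod θ l * PushoutI.base θ b ∧
        w.toList.map Sigma.fst = l.indices := by
  obtain ⟨l', b', hl', hind, heq⟩ := hl.exists_mul_base b
  let w : CoprodI.Word M :=
    { toList := l'
      ne_one := fun s hs h1 => hl'.1 s hs (h1 ▸ one_mem _)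
      chain_ne := by simpa [indices, List.isChain_map] using hl'.2 }
  obtain ⟨w', hprod, hmap⟩ := PushoutI.Reduced.exists_normalWord_prod_eq d (w := w) hl'.1
  refine ⟨(a * b') • w', ?_, hmap.trans hind⟩
  rw [PushoutI.NormalWord.prod_base_smul, hprod, mul_assoc, heq, map_mul, mul_assoc]
  simp [CoprodI.Word.prod, w, prod, map_list_prod, Function.comp_def]

theorem indices_eq_of_base_mul_prod_eq (hθ : ∀ i, Function.Injective (θ i)) {l l' : Syllables M}
    {a b c d : H} (hl : IsReduced θ l) (hl' : IsReduced θ l')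
    (h : PushoutI.base θ a * prod θ l * PushoutI.base θ b =
      PushoutI.base θ c * prod θ l' * PushoutI.base θ d) : l.indices = l'.indices := by
  obtain ⟨T⟩ := PushoutI.NormalWord.transversal_nonempty θ hθ
  obtain ⟨w, hw, hind⟩ := hl.exists_normalWord T a b
  obtain ⟨w', hw', hind'⟩ := hl'.exists_normalWord T c d
  rw [← hind, ← hind', PushoutI.NormalWord.prod_injective (hw.trans (h.trans hw'.symm))]

end Syllables

open Classical in
/-- The sequence of factors in which the syllables of the reduced forms of `g` lie; the value is
junk when `g` has no reduced form, which cannot happen when the maps `θ i` are injective. -/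
noncomputable def factorSeq (g : PushoutI θ) : List ι :=
  Classical.epsilon fun L => ∃ (c : H) (l : Syllables M),
    l.IsReduced θ ∧ l.indices = L ∧ g = PushoutI.base θ c * l.prod θ

namespace Syllables

theorem IsReduced.factorSeq_eq (hθ : ∀ i, Function.Injective (θ i)) {l : Syllables M}
    (hl : IsReduced θ l) (a b : H) :
    factorSeq (PushoutI.base θ a * prod θ l * PushoutI.base θ b) = l.indices := by
  obtain ⟨c, l', hl', heq⟩ :=
    exists_reduced_form hθ (PushoutI.base θ a * prod θ l * PushoutI.base θ b)
  obtain ⟨c', l'', hl'', hind, heq'⟩ := Classical.epsilon_spec (p := fun L =>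
    ∃ (c : H) (l' : Syllables M), l'.IsReduced θ ∧ l'.indices = L ∧
      PushoutI.base θ a * prod θ l * PushoutI.base θ b = PushoutI.base θ c * l'.prod θ)
    ⟨_, c, l', hl', rfl, heq⟩
  rw [factorSeq, ← hind]
  refine indices_eq_of_base_mul_prod_eq hθ hl'' hl (a := c') (b := 1) (c := a) (d := b) ?_
  rw [map_one, mul_one, heq']

theorem IsReduced.factorSeq_prod (hθ : ∀ i, Function.Injective (θ i)) {l : Syllables M}
    (hl : IsReduced θ l) : factorSeq (prod θ l) = l.indices := by
  simpa using hl.factorSeq_eq hθ 1 1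

theorem IsReduced.factorSeq_base_mul (hθ : ∀ i, Function.Injective (θ i)) {l : Syllables M}
    (hl : IsReduced θ l) (a : H) : factorSeq (PushoutI.base θ a * prod θ l) = l.indices := by
  simpa using hl.factorSeq_eq hθ a 1

theorem factorSeq_inv (hθ : ∀ i, Function.Injective (θ i)) (g : PushoutI θ) :
    factorSeq g⁻¹ = (factorSeq g).reverse := by
  obtain ⟨c, l, hl, rfl⟩ := exists_reduced_form hθ g
  have := hl.inv.factorSeq_eq hθ 1 c⁻¹
  rw [hl.factorSeq_base_mul hθ, ← indices_inv, ← this]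
  simp

theorem factorSeq_eq_nil_iff (hθ : ∀ i, Function.Injective (θ i)) {g : PushoutI θ} :
    factorSeq g = [] ↔ g ∈ (PushoutI.base θ).range := by
  constructor
  · intro h
    obtain ⟨c, l, hl, rfl⟩ := exists_reduced_form hθ g
    rw [hl.factorSeq_base_mul hθ, indices_eq_nil] at h
    exact ⟨c, by simp [h]⟩
  · rintro ⟨c, rfl⟩
    simpa using isReduced_nil.factorSeq_base_mul hθ c

end Syllables
end Syllables

section Conjugacy

/-- A sequence of factors that may be the one of a cyclically reduced element: it has length at
most one, or its first and last entries are different. -/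
def CyclicallyAlternating {ι : Type*} (L : List ι) : Prop := L.length ≤ 1 ∨ L.head? ≠ L.getLast?

lemma CyclicallyAlternating.reverse {ι : Type*} {L : List ι} (h : CyclicallyAlternating L) :
    CyclicallyAlternating L.reverse := by
  simpa [CyclicallyAlternating, ne_comm] using h

lemma not_cyclicallyAlternating_reverse_append_append {ι : Type*} {t core : List ι}
    (hcore : core.head? = core.getLast?) (hlen : 2 ≤ core.length ∨ (core ≠ [] ∧ t ≠ [])) :
    ¬ CyclicallyAlternating (t.reverse ++ core ++ t) := by
  rintro (hle | hne)
  · simp only [List.length_append, List.length_reverse] at hle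
    rcases hlen with h | ⟨hcore, ht⟩
    · omega
    · have := List.length_pos_of_ne_nil hcore
      have := List.length_pos_of_ne_nil ht
      omega
  · rcases t with _ | ⟨a, t⟩
    · exact hne (by simpa using hcore)
    · simp [List.head?_append, List.getLast?_append, List.getLast?_cons] at hne

lemma length_eq_one_or_exists_eq_cons_append_singleton {α : Type*} {l : List α} (hl : l ≠ []) :
    l.length = 1 ∨ ∃ a m b, l = a :: (m ++ [b]) := by
  rcases l with _ | ⟨a, t⟩
  · exact (hl rfl).elim
  · rcases List.eq_nil_or_concat t with rfl | ⟨m, b, rfl⟩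
    · exact .inl rfl
    · exact .inr ⟨a, m, b, by simp⟩

namespace Syllables

section

variable {ι : Type*} {M : ι → Type*} [∀ i, Group (M i)] {H : Type*} [Group H] {θ : ∀ i, H →* M i}

lemma not_cyclicallyAlternating_conj (hθ : ∀ i, Function.Injective (θ i)) {t core : Syllables M}
    (c : H) (hr : IsReduced θ (inv t ++ core ++ t))
    (hcore : core.indices.head? = core.indices.getLast?)
    (hlen : 2 ≤ core.length ∨ (core ≠ [] ∧ t ≠ [])) :
    ¬ CyclicallyAlternating (factorSeq
      ((prod θ t * PushoutI.base θ c)⁻¹ * prod θ core * (prod θ t * PushoutI.base θ c))) := by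
  have hseq : factorSeq
      ((prod θ t * PushoutI.base θ c)⁻¹ * prod θ core * (prod θ t * PushoutI.base θ c)) =
        t.indices.reverse ++ core.indices ++ t.indices := by
    have := hr.factorSeq_eq hθ c⁻¹ c
    simp only [prod_append, prod_inv, indices_append, indices_inv, map_inv] at this
    rw [← this]
    group
  rw [hseq]
  exact not_cyclicallyAlternating_reverse_append_append hcore (by simpa using hlen)

theorem exists_conj_cyclicallyAlternating (hθ : ∀ i, Function.Injective (θ i)) (g : PushoutI θ) :
    ∃ z : PushoutI θ, CyclicallyAlternating (factorSeq (z⁻¹ * g * z)) := by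
  induction hn : (factorSeq g).length using Nat.strong_induction_on generalizing g with
  | _ n ih =>
    by_cases hcyc : CyclicallyAlternating (factorSeq g)
    · exact ⟨1, by simpa using hcyc⟩
    suffices ∃ z : PushoutI θ, (factorSeq (z⁻¹ * g * z)).length < n by
      obtain ⟨z, hz⟩ := this
      obtain ⟨z', hz'⟩ := ih _ hz _ rfl
      exact ⟨z * z', by simpa [mul_assoc] using hz'⟩
    obtain ⟨c, l, hl, rfl⟩ := exists_reduced_form hθ g
    rw [hl.factorSeq_base_mul hθ] at hcyc hn
    obtain ⟨hlen, hends⟩ := not_or.1 hcyc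
    rw [length_indices] at hlen hn
    obtain hone | ⟨⟨i, a⟩, m, ⟨j, b⟩, rfl⟩ :=
      length_eq_one_or_exists_eq_cons_append_singleton (l := l) (by rintro rfl; simp at hlen)
    · omega
    obtain rfl : i = j := by simpa [List.getLast?_cons] using hends
    obtain ⟨-, hmb, hm⟩ := isReduced_cons_iff.1 hl
    have hmred := (isReduced_append_iff.1 hmb).1.1
    have hconj : (PushoutI.of i b)⁻¹⁻¹ * (PushoutI.base θ c * prod θ (⟨i, a⟩ :: (m ++ [⟨i, b⟩]))) *
        (PushoutI.of i b)⁻¹ = PushoutI.of i (b * θ i c * a) * prod θ m := by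
      simp [mul_assoc, PushoutI.of_apply_eq_base]
    refine ⟨(PushoutI.of i b)⁻¹, hn ▸ ?_⟩
    rw [hconj]
    by_cases hmem : b * θ i c * a ∈ (θ i).range
    · obtain ⟨e, he⟩ := hmem
      rw [← he, PushoutI.of_apply_eq_base, hmred.factorSeq_base_mul hθ]
      simp
    · have hne : ∀ y ∈ (indices m).head?, i ≠ y := fun y hy =>
        hm y (by simp [List.head?_append, Option.mem_def.1 hy])
      rw [← prod_cons ⟨i, b * θ i c * a⟩,
        (isReduced_cons_iff.2 ⟨hmem, hmred, hne⟩).factorSeq_prod hθ]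
      simp

lemma eq_nil_of_cyclicallyAlternating_conj_of (hθ : ∀ i, Function.Injective (θ i)) {i : ι}
    {x : M i} (hx : x ∉ (θ i).range) {t : Syllables M} (ht : IsReduced θ t)
    (hi : ∀ j ∈ t.indices.head?, i ≠ j) {c : H}
    (hcyc : CyclicallyAlternating (factorSeq
      ((prod θ t * PushoutI.base θ c)⁻¹ * PushoutI.of i x * (prod θ t * PushoutI.base θ c)))) :
    t = [] := by
  by_contra hne
  have hr : IsReduced θ (inv t ++ [⟨i, x⟩] ++ t) := by
    rw [isReduced_append_iff, isReduced_append_iff]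
    exact ⟨⟨⟨⟨ht.inv, isReduced_singleton hx⟩, by simpa [ne_comm] using hi⟩, ht⟩,
      by simpa using hi⟩
  exact not_cyclicallyAlternating_conj hθ c hr (by simp) (.inr ⟨by simp, hne⟩)
    (by simpa using hcyc)

theorem exists_mem_factor_of_conj_elliptic (hθ : ∀ i, Function.Injective (θ i))
    {u z : PushoutI θ} {i : ι} (hu : u ∈ (PushoutI.of (φ := θ) i).range)
    (hconj : ∀ j, u ∈ (PushoutI.of (φ := θ) j).range → ∀ g : M j,
      (PushoutI.of j g)⁻¹ * u * PushoutI.of j g ∈ (PushoutI.base θ).range → g ∈ (θ j).range)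
    (hcyc : CyclicallyAlternating (factorSeq (z⁻¹ * u * z))) :
    ∃ j, u ∈ (PushoutI.of (φ := θ) j).range ∧ z ∈ (PushoutI.of (φ := θ) j).range := by
  obtain ⟨c, l, hl, hzl⟩ := exists_reduced_form hθ z
  obtain ⟨l, c, hl, -, heq⟩ := hl.exists_base_mul c
  obtain rfl := hzl.trans heq
  rcases l with _ | ⟨⟨j, s⟩, t⟩
  · exact ⟨i, hu, by simpa using base_mem_of_range i c⟩
  obtain ⟨hs, ht, hj⟩ := isReduced_cons_iff.1 hl
  by_cases huj : u ∈ (PushoutI.of (φ := θ) j).range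
  · refine ⟨j, huj, ?_⟩
    obtain ⟨x, rfl⟩ := id huj
    have hxs : s⁻¹ * x * s ∉ (θ j).range := fun hmem =>
      hs (hconj j huj s (by simpa using (of_mem_base_range hθ).2 hmem))
    obtain rfl := eq_nil_of_cyclicallyAlternating_conj_of hθ (c := c) hxs ht hj
      (by simpa [mul_assoc] using hcyc)
    simpa using mul_mem (MonoidHom.mem_range.2 ⟨s, rfl⟩) (base_mem_of_range j c)
  · obtain ⟨x, rfl⟩ := hu
    have hij : i ≠ j := by rintro rfl; exact huj ⟨x, rfl⟩
    have hx : x ∉ (θ i).range := by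
      rintro ⟨e, rfl⟩
      exact huj (by simpa only [PushoutI.of_apply_eq_base] using base_mem_of_range j e)
    have := eq_nil_of_cyclicallyAlternating_conj_of hθ hx hl (by simpa using hij) hcyc
    simp at this

lemma inv_mul_mem_range_of_cyclicallyAlternating_conj (hθ : ∀ i, Function.Injective (θ i)) {i k : ι}
    {a s : M i} {b : M k} {m t : Syllables M} {c : H} (hik : i ≠ k)
    (hl : IsReduced θ (⟨i, a⟩ :: (m ++ [⟨k, b⟩]))) (hz : IsReduced θ (⟨i, s⟩ :: t))
    (hcyc : CyclicallyAlternating (factorSeq ((prod θ (⟨i, s⟩ :: t) * PushoutI.base θ c)⁻¹ *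
      prod θ (⟨i, a⟩ :: (m ++ [⟨k, b⟩])) * (prod θ (⟨i, s⟩ :: t) * PushoutI.base θ c)))) :
    s⁻¹ * a ∈ (θ i).range := by
  by_contra hmem
  obtain ⟨-, hm, him⟩ := isReduced_cons_iff.1 hl
  obtain ⟨hs, ht, hit⟩ := isReduced_cons_iff.1 hz
  have hcore : IsReduced θ (⟨i, s⁻¹ * a⟩ :: (m ++ [⟨k, b⟩]) ++ [⟨i, s⟩]) :=
    isReduced_append_iff.2 ⟨⟨isReduced_cons_iff.2 ⟨hmem, hm, him⟩, isReduced_singleton hs⟩,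
      by simpa [List.getLast?_cons] using hik.symm⟩
  have hr : IsReduced θ (inv t ++ (⟨i, s⁻¹ * a⟩ :: (m ++ [⟨k, b⟩]) ++ [⟨i, s⟩]) ++ t) := by
    rw [isReduced_append_iff, isReduced_append_iff]
    exact ⟨⟨⟨⟨ht.inv, hcore⟩, by simpa [ne_comm] using hit⟩, ht⟩,
      by simpa [List.getLast?_cons] using hit⟩
  refine not_cyclicallyAlternating_conj hθ c hr (by simp [List.getLast?_cons]) (.inl (by simp)) ?_
  simpa [mul_assoc] using hcyc

lemma exists_rotation_step (hθ : ∀ i, Function.Injective (θ i)) {i k : ι}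
    {a s : M i} {b : M k} {m t : Syllables M} {c : H} (hik : i ≠ k)
    (hl : IsReduced θ (⟨i, a⟩ :: (m ++ [⟨k, b⟩]))) (hz : IsReduced θ (⟨i, s⟩ :: t))
    (hcyc : CyclicallyAlternating (factorSeq ((prod θ (⟨i, s⟩ :: t) * PushoutI.base θ c)⁻¹ *
      prod θ (⟨i, a⟩ :: (m ++ [⟨k, b⟩])) * (prod θ (⟨i, s⟩ :: t) * PushoutI.base θ c)))) :
    ∃ (l₁ t' : Syllables M) (c' : H), (⟨i, a⟩ :: (m ++ [⟨k, b⟩])) ~r l₁ ∧ IsReduced θ l₁ ∧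
      l₁.indices.head? ≠ l₁.indices.getLast? ∧ IsReduced θ t' ∧ t'.length = t.length ∧
      (prod θ t' * PushoutI.base θ c')⁻¹ * prod θ l₁ * (prod θ t' * PushoutI.base θ c') =
        (prod θ (⟨i, s⟩ :: t) * PushoutI.base θ c)⁻¹ * prod θ (⟨i, a⟩ :: (m ++ [⟨k, b⟩])) *
          (prod θ (⟨i, s⟩ :: t) * PushoutI.base θ c) := by
  obtain ⟨e, he⟩ := inv_mul_mem_range_of_cyclicallyAlternating_conj hθ hik hl hz hcyc
  obtain ⟨ha, hm, him⟩ := isReduced_cons_iff.1 hl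
  have hbase : PushoutI.base θ e⁻¹ = (PushoutI.of i a)⁻¹ * PushoutI.of i s := by
    rw [← PushoutI.of_apply_eq_base θ i, map_inv, he]; simp
  obtain ⟨t', c', ht', hind, heq⟩ := (isReduced_cons_iff.1 hz).2.1.exists_base_mul e⁻¹
  refine ⟨(m ++ [⟨k, b⟩]) ++ [⟨i, a⟩], t', c' * c, ⟨1, by simp⟩,
    isReduced_append_iff.2 ⟨⟨hm, isReduced_singleton ha⟩, by simpa using hik.symm⟩,
    fun hends => him i (by rw [indices_append, List.head?_append_of_ne_nil _ (by simp)] at hends;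
                           simpa using hends) rfl,
    ht', by simpa using congrArg List.length hind, ?_⟩
  rw [map_mul, ← mul_assoc (prod θ t'), ← heq, hbase]
  simp [mul_assoc]

end

section

variable {M : Bool → Type*} [∀ i, Group (M i)] {H : Type*} [Group H] {θ : ∀ i, H →* M i}

lemma inv_isRotated_inv {l l' : Syllables M} (h : l ~r l') : inv l ~r inv l' :=
  (h.map _).reverse

/-- With only two factors, the first syllable of the conjugator cancels against the first or the
last syllable of a cyclically reduced `l`; the second case is the first one for `inv l`. -/
lemma exists_isRotated_conj_eq_of_cons (hθ : ∀ i, Function.Injective (θ i)) {l t : Syllables M}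
    {i : Bool} {s : M i} {c : H} (hl : IsReduced θ l)
    (hends : l.indices.head? ≠ l.indices.getLast?) (hz : IsReduced θ (⟨i, s⟩ :: t))
    (hcyc : CyclicallyAlternating (factorSeq ((prod θ (⟨i, s⟩ :: t) * PushoutI.base θ c)⁻¹ *
      prod θ l * (prod θ (⟨i, s⟩ :: t) * PushoutI.base θ c)))) :
    ∃ (l₁ t' : Syllables M) (c' : H), l ~r l₁ ∧ IsReduced θ l₁ ∧
      l₁.indices.head? ≠ l₁.indices.getLast? ∧ IsReduced θ t' ∧ t'.length = t.length ∧
      (prod θ t' * PushoutI.base θ c')⁻¹ * prod θ l₁ * (prod θ t' * PushoutI.base θ c') =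
        (prod θ (⟨i, s⟩ :: t) * PushoutI.base θ c)⁻¹ * prod θ l *
          (prod θ (⟨i, s⟩ :: t) * PushoutI.base θ c) := by
  obtain hone | ⟨⟨j, a⟩, m, ⟨k, b⟩, rfl⟩ :=
    length_eq_one_or_exists_eq_cons_append_singleton (l := l) (by rintro rfl; simp at hends)
  · obtain ⟨x, rfl⟩ := List.length_eq_one_iff.1 hone
    simp at hends
  have hjk : j ≠ k := by simpa [List.getLast?_cons] using hends
  obtain rfl | rfl : i = j ∨ i = k :=
    (by decide : ∀ i j k : Bool, j ≠ k → i = j ∨ i = k) i j k hjk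
  · exact exists_rotation_step hθ hjk hl hz hcyc
  · have hinv : inv (⟨j, a⟩ :: (m ++ [⟨i, b⟩])) = ⟨i, b⁻¹⟩ :: (inv m ++ [⟨j, a⁻¹⟩]) := by
      simp [inv]
    obtain ⟨l₁, t', c', hrot, hl₁, hends₁, ht', hlen, heq⟩ :=
      exists_rotation_step hθ (c := c) hjk.symm (hinv ▸ hl.inv) hz (by
        have := hcyc.reverse
        rw [← factorSeq_inv hθ] at this
        rw [← hinv, prod_inv]
        simpa only [mul_inv_rev, _root_.inv_inv, mul_assoc] using this)
    rw [← hinv] at hrot heq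
    refine ⟨inv l₁, t', c', by simpa using inv_isRotated_inv hrot, hl₁.inv,
      by simpa [ne_comm] using hends₁, ht', hlen, inv_injective ?_⟩
    rw [prod_inv] at heq
    simpa [mul_assoc] using heq

theorem exists_isRotated_of_cyclicallyAlternating_conj (hθ : ∀ i, Function.Injective (θ i))
    {l : Syllables M} {z : PushoutI θ} (hl : IsReduced θ l)
    (hends : l.indices.head? ≠ l.indices.getLast?)
    (hcyc : CyclicallyAlternating (factorSeq (z⁻¹ * prod θ l * z))) :
    ∃ (l₁ : Syllables M) (e : H), l ~r l₁ ∧ IsReduced θ l₁ ∧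
      (PushoutI.base θ e)⁻¹ * prod θ l₁ * PushoutI.base θ e = z⁻¹ * prod θ l * z := by
  obtain ⟨c, lz, hz, hzeq⟩ := exists_reduced_form hθ z
  obtain ⟨lz, c, hz, -, heq⟩ := hz.exists_base_mul c
  obtain rfl := hzeq.trans heq
  clear hzeq heq
  induction hn : lz.length generalizing l lz c with
  | zero =>
    obtain rfl := List.length_eq_zero_iff.1 hn
    exact ⟨l, c, .refl l, hl, by simp⟩
  | succ n ih =>
    obtain ⟨⟨i, s⟩, t, rfl⟩ := List.exists_cons_of_length_eq_add_one hn
    obtain ⟨l₁, t', c', hrot, hl₁, hends₁, ht', hlen, heq⟩ :=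
      exists_isRotated_conj_eq_of_cons hθ hl hends hz hcyc
    obtain ⟨l₂, e, hrot₂, hl₂, heq₂⟩ := ih hl₁ hends₁ t' c' ht' (heq ▸ hcyc) (by simp_all)
    exact ⟨l₂, e, hrot.trans hrot₂, hl₂, heq₂.trans heq⟩

end
end Syllables
end Conjugacy

section Prefixes

open FreeGroup

variable {α : Type*}

lemma exists_mk_take_of_red {L L' : List (α × Bool)} (h : Red L L') (j : ℕ) :
    ∃ k, mk (L.take k) = mk (L'.take j) := by
  induction h generalizing j with
  | refl => exact ⟨j, rfl⟩
  | tail _ hstep ih =>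
    obtain @⟨L₁, L₂, x, b⟩ := hstep
    rcases le_or_gt j L₁.length with hj | hj
    · obtain ⟨k, hk⟩ := ih j
      exact ⟨k, by rw [hk, List.take_append_of_le_length hj, List.take_append_of_le_length hj]⟩
    · obtain ⟨i, rfl⟩ := Nat.exists_eq_add_of_le hj.le
      obtain ⟨k, hk⟩ := ih (L₁.length + (i + 2))
      refine ⟨k, hk.trans ?_⟩
      rw [List.take_length_add_append, List.take_length_add_append]
      exact Quot.sound Red.Step.not

variable [DecidableEq α]

/-- The element represented by the prefix of length `j` of the reduced word of `x`, that is, the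
point at distance `j` from `1` on the geodesic from `1` to `x`; it is `x` when `norm x ≤ j`. -/
def wordPrefix (x : FreeGroup α) (j : ℕ) : FreeGroup α := mk (x.toWord.take j)

@[simp] lemma wordPrefix_zero (x : FreeGroup α) : wordPrefix x 0 = 1 := by
  simp [wordPrefix, one_eq_mk]

lemma wordPrefix_of_norm_le {x : FreeGroup α} {j : ℕ} (h : norm x ≤ j) : wordPrefix x j = x := by
  rw [wordPrefix, List.take_of_length_le h, mk_toWord]

@[simp] lemma wordPrefix_norm (x : FreeGroup α) : wordPrefix x (norm x) = x :=
  wordPrefix_of_norm_le le_rfl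

@[simp] lemma wordPrefix_min_norm (x : FreeGroup α) (j : ℕ) :
    wordPrefix x (min j (norm x)) = wordPrefix x j := by
  rcases le_total j (norm x) with h | h
  · rw [min_eq_left h]
  · rw [min_eq_right h, wordPrefix_norm, wordPrefix_of_norm_le h]

lemma inv_wordPrefix_mul_wordPrefix (x : FreeGroup α) {i j : ℕ} (h : i ≤ j) :
    (wordPrefix x i)⁻¹ * wordPrefix x j = mk ((x.toWord.take j).drop i) := by
  rw [inv_mul_eq_iff_eq_mul, wordPrefix, wordPrefix, mul_mk]
  conv_lhs => rw [← List.take_append_drop i (x.toWord.take j)]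
  rw [List.take_take, min_eq_left h]

lemma norm_mk_of_isInfix {x : FreeGroup α} {L : List (α × Bool)} (h : L <:+: x.toWord) :
    norm (mk L) = L.length := by
  rw [FreeGroup.norm, toWord_mk, (isReduced_toWord.infix h).reduce_eq]

lemma norm_inv_wordPrefix_mul_wordPrefix (x : FreeGroup α) {i j : ℕ} (h : i ≤ j) :
    norm ((wordPrefix x i)⁻¹ * wordPrefix x j) = min j (norm x) - i := by
  rw [inv_wordPrefix_mul_wordPrefix x h, norm_mk_of_isInfix
    ((List.drop_suffix _ _).isInfix.trans (List.take_prefix _ _).isInfix), List.length_drop,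
    List.length_take, FreeGroup.norm]

lemma norm_wordPrefix (x : FreeGroup α) (j : ℕ) : norm (wordPrefix x j) = min j (norm x) := by
  simpa using norm_inv_wordPrefix_mul_wordPrefix x (Nat.zero_le j)

lemma norm_inv_wordPrefix_mul (x : FreeGroup α) (i : ℕ) :
    norm ((wordPrefix x i)⁻¹ * x) = norm x - i := by
  have := norm_inv_wordPrefix_mul_wordPrefix x (le_max_left i (norm x))
  rwa [wordPrefix_of_norm_le (le_max_right _ _), min_eq_right (le_max_right _ _)] at this

lemma norm_inv_wordPrefix_mul_wordPrefix_succ_le (x : FreeGroup α) (i : ℕ) :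
    norm ((wordPrefix x i)⁻¹ * wordPrefix x (i + 1)) ≤ 1 := by
  have := norm_inv_wordPrefix_mul_wordPrefix x (i := i) (j := i + 1) (by omega)
  omega

lemma norm_inv_mul_comm (x y : FreeGroup α) : norm (x⁻¹ * y) = norm (y⁻¹ * x) := by
  rw [← norm_inv_eq]
  simp

lemma norm_inv_mul_le (x y z : FreeGroup α) :
    norm (x⁻¹ * z) ≤ norm (x⁻¹ * y) + norm (y⁻¹ * z) := by
  have := norm_mul_le (x⁻¹ * y) (y⁻¹ * z)
  simpa [mul_assoc] using this

lemma exists_wordPrefix_mul_eq (x y : FreeGroup α) (j : ℕ) :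
    (∃ k, wordPrefix (x * y) j = wordPrefix x k) ∨
      ∃ k, wordPrefix (x * y) j = x * wordPrefix y k := by
  have hred : Red (x.toWord ++ y.toWord) (x * y).toWord := by
    have := reduce.red (L := x.toWord ++ y.toWord)
    rwa [← toWord_mk, ← mul_mk, mk_toWord, mk_toWord] at this
  obtain ⟨k, hk⟩ := exists_mk_take_of_red hred j
  rw [wordPrefix, ← hk]
  rcases le_total k x.toWord.length with h | h
  · exact .inl ⟨k, by rw [List.take_append_of_le_length h, wordPrefix]⟩
  · refine .inr ⟨k - x.toWord.length, ?_⟩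
    rw [List.take_append, List.take_of_length_le h, ← mul_mk, mk_toWord, wordPrefix]

/-- The Cayley graph is a tree, so a path from `1` to `w n` with jumps of length at most `M`
passes near every point of the geodesic. -/
lemma exists_norm_inv_wordPrefix_mul_le (w : ℕ → FreeGroup α) (h0 : w 0 = 1) {M : ℕ} (n : ℕ)
    (hw : ∀ i < n, norm ((w i)⁻¹ * w (i + 1)) ≤ M) (j : ℕ) :
    ∃ i ≤ n, norm ((wordPrefix (w n) j)⁻¹ * w i) ≤ M := by
  induction n generalizing j with
  | zero => exact ⟨0, le_rfl, by simp [h0, wordPrefix, ← one_eq_mk]⟩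
  | succ n ih =>
    have hstep := exists_wordPrefix_mul_eq (w n) ((w n)⁻¹ * w (n + 1)) j
    rw [mul_inv_cancel_left] at hstep
    rcases hstep with ⟨k, hk⟩ | ⟨k, hk⟩
    · obtain ⟨i, hi, hle⟩ := ih (fun i hi => hw i (by omega)) k
      exact ⟨i, by omega, hk ▸ hle⟩
    · refine ⟨n, Nat.le_succ n, ?_⟩
      rw [hk, mul_inv_rev, mul_assoc, inv_mul_cancel, mul_one, norm_inv_eq, norm_wordPrefix]
      exact (min_le_right _ _).trans (hw n (Nat.lt_succ_self n))

/-- Opposite sides of the quadrilateral `1, g, g d = c h, c` stay close to each other. -/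
lemma exists_norm_inv_wordPrefix_mul_mul_le {g h c d : FreeGroup α} (hd : d = g⁻¹ * c * h)
    (j : ℕ) : ∃ i ≤ norm d,
      norm ((wordPrefix c j)⁻¹ * g * wordPrefix d i) ≤ max (norm g) (norm h) := by
  have hc : c = g * (d * h⁻¹) := by rw [hd]; group
  rw [hc]
  rcases exists_wordPrefix_mul_eq g (d * h⁻¹) j with ⟨k, hk⟩ | ⟨k, hk⟩
  · refine ⟨0, Nat.zero_le _, le_max_of_le_left ?_⟩
    rw [hk, wordPrefix_zero, mul_one, norm_inv_wordPrefix_mul]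
    exact Nat.sub_le _ _
  rw [hk, mul_inv_rev, inv_mul_cancel_right]
  rcases exists_wordPrefix_mul_eq d h⁻¹ k with ⟨i, hi⟩ | ⟨i, hi⟩
  · exact ⟨min i (norm d), min_le_right _ _, by simp [hi]⟩
  · refine ⟨norm d, le_rfl, le_max_of_le_right ?_⟩
    rw [hi, wordPrefix_norm, mul_inv_rev, inv_mul_cancel_right, norm_inv_eq, norm_wordPrefix,
      norm_inv_eq]
    exact min_le_right _ _

end Prefixes

section Counting

open FreeGroup

/-- All words of length at most `k` over a list of letters. -/
def wordsLE {α : Type*} (letters : List α) : ℕ → List (List α)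
  | 0 => [[]]
  | k + 1 => [] :: (wordsLE letters k).flatMap fun w => letters.map (· :: w)

lemma mem_wordsLE {α : Type*} {letters : List α} (h : ∀ a, a ∈ letters) {k : ℕ} {w : List α} :
    w ∈ wordsLE letters k ↔ w.length ≤ k := by
  induction k generalizing w with
  | zero => simp [wordsLE]
  | succ k ih =>
    cases w with
    | nil => simp [wordsLE]
    | cons a w => simp [wordsLE, ih, h]

lemma length_wordsLE_le {α : Type*} (letters : List α) (k : ℕ) :
    (wordsLE letters k).length ≤ (letters.length + 1) ^ k := by
  induction k with
  | zero => rfl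
  | succ k ih =>
    simp only [wordsLE, List.length_cons, List.length_flatMap, List.length_map, List.map_const',
      List.sum_replicate, smul_eq_mul]
    calc (wordsLE letters k).length * letters.length + 1
        ≤ (letters.length + 1) ^ k * letters.length + (letters.length + 1) ^ k :=
          Nat.add_le_add (Nat.mul_le_mul_right _ ih) (Nat.one_le_pow _ _ (Nat.succ_pos _))
      _ = (letters.length + 1) ^ (k + 1) := by ring

lemma exists_lt_eq_of_length_le {α : Type*} [Fintype α] {k J : ℕ} (f : ℕ → List α)
    (hf : ∀ j ≤ J, (f j).length ≤ k) (hJ : (Fintype.card α + 1) ^ k ≤ J) :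
    ∃ i j, i < j ∧ j ≤ J ∧ f i = f j := by
  classical
  let letters : List α := Finset.univ.toList
  have hmem : ∀ a, a ∈ letters := by simp [letters]
  have hcard : (wordsLE letters k).toFinset.card < (Finset.range (J + 1)).card := by
    rw [Finset.card_range]
    refine Nat.lt_succ_of_le ((List.toFinset_card_le _).trans
      ((length_wordsLE_le _ _).trans (le_of_eq_of_le ?_ hJ)))
    simp [letters]
  obtain ⟨i, hi, j, hj, hne, heq⟩ := Finset.exists_ne_map_eq_of_card_lt_of_maps_to hcard
    (f := f) fun j hj => by simpa [mem_wordsLE hmem] using hf j (by simpa using hj)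
  simp only [Finset.mem_range, Nat.lt_succ_iff] at hi hj
  rcases lt_or_gt_of_ne hne with h | h
  · exact ⟨i, j, h, hj, heq⟩
  · exact ⟨j, i, h, hi, heq.symm⟩

/-- A bound for the number of elements of norm at most `k` in a free group. -/
def ballBound (α : Type*) [Fintype α] (k : ℕ) : ℕ := (2 * Fintype.card α + 1) ^ k

lemma ballBound_mono (α : Type*) [Fintype α] : Monotone (ballBound α) :=
  fun _ _ h => Nat.pow_le_pow_right (Nat.succ_pos _) h

lemma exists_lt_eq_of_norm_le {α : Type*} [Fintype α] [DecidableEq α] {k J : ℕ}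
    (f : ℕ → FreeGroup α) (hf : ∀ j ≤ J, norm (f j) ≤ k) (hJ : ballBound α k ≤ J) :
    ∃ i j, i < j ∧ j ≤ J ∧ f i = f j := by
  obtain ⟨i, j, hij, hj, heq⟩ := exists_lt_eq_of_length_le (fun j => (f j).toWord) hf
    (by simpa [ballBound, mul_comm] using hJ)
  exact ⟨i, j, hij, hj, toWord_injective heq⟩

end Counting

section Pumping

open FreeGroup

variable {α : Type*} [DecidableEq α]

lemma norm_wordPrefix_mul_inv_lt {z : FreeGroup α} {i j : ℕ} (hij : i < j) (hj : 2 * j ≤ norm z) :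
    norm (wordPrefix z j * (wordPrefix z i)⁻¹) < norm z := by
  have := norm_mul_le (wordPrefix z j) (wordPrefix z i)⁻¹
  rw [norm_inv_eq, norm_wordPrefix, norm_wordPrefix] at this
  omega

lemma norm_wordPrefix_mul_inv_mul_lt {z : FreeGroup α} {i j : ℕ} (hij : i < j)
    (hj : j ≤ norm z) : norm (wordPrefix z i * (wordPrefix z j)⁻¹ * z) < norm z := by
  have := norm_mul_le (wordPrefix z i) ((wordPrefix z j)⁻¹ * z)
  rw [norm_wordPrefix, norm_inv_wordPrefix_mul, ← mul_assoc] at this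
  omega

lemma norm_inv_wordPrefix_mul_mul_wordPrefix_le (u z : FreeGroup α) {j : ℕ} (hj : j ≤ norm z) :
    norm ((wordPrefix z j)⁻¹ * u * wordPrefix z j) ≤ 3 * (norm u + norm (z⁻¹ * u * z)) := by
  obtain ⟨i, hi, hle⟩ := exists_norm_inv_wordPrefix_mul_mul_le (g := u) (h := z⁻¹ * u * z)
    (c := z) (d := z) (by group) j
  have hmax : max (norm u) (norm (z⁻¹ * u * z)) ≤ norm u + norm (z⁻¹ * u * z) := by omega
  have hnorm_i : norm (wordPrefix z i) = i := by rw [norm_wordPrefix, min_eq_left hi]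
  have hnorm_j : norm (wordPrefix z j) = j := by rw [norm_wordPrefix, min_eq_left hj]
  have hij : i ≤ j + (norm u + norm ((wordPrefix z j)⁻¹ * u * wordPrefix z i)) := by
    have h₁ := norm_mul_le (u⁻¹ * wordPrefix z j) ((wordPrefix z j)⁻¹ * u * wordPrefix z i)
    have h₂ := norm_mul_le u⁻¹ (wordPrefix z j)
    rw [show u⁻¹ * wordPrefix z j * ((wordPrefix z j)⁻¹ * u * wordPrefix z i) = wordPrefix z i by
      group] at h₁
    rw [norm_inv_eq] at h₂
    omega
  have hji : j ≤ i + (norm u + norm ((wordPrefix z j)⁻¹ * u * wordPrefix z i)) := by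
    have h₁ := norm_mul_le (u * wordPrefix z i) ((wordPrefix z j)⁻¹ * u * wordPrefix z i)⁻¹
    have h₂ := norm_mul_le u (wordPrefix z i)
    rw [show u * wordPrefix z i * ((wordPrefix z j)⁻¹ * u * wordPrefix z i)⁻¹ = wordPrefix z j by
      group, norm_inv_eq] at h₁
    omega
  have hdist : norm ((wordPrefix z i)⁻¹ * wordPrefix z j) ≤ (j - i) + (i - j) := by
    rcases le_total i j with h | h
    · rw [norm_inv_wordPrefix_mul_wordPrefix z h]
      omega
    · rw [norm_inv_mul_comm, norm_inv_wordPrefix_mul_wordPrefix z h]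
      omega
  have := norm_mul_le ((wordPrefix z j)⁻¹ * u * wordPrefix z i)
    ((wordPrefix z i)⁻¹ * wordPrefix z j)
  rw [show (wordPrefix z j)⁻¹ * u * wordPrefix z i * ((wordPrefix z i)⁻¹ * wordPrefix z j) =
    (wordPrefix z j)⁻¹ * u * wordPrefix z j by group] at this
  omega

/-- Two prefixes of the conjugator at which `u` has the same conjugate can be interchanged, which
cuts the conjugator into two shorter factors. -/
lemma exists_eq_mul_of_le_norm_conjugator [Fintype α] (u z : FreeGroup α)
    (hz : 2 * ballBound α (3 * (norm u + norm (z⁻¹ * u * z))) ≤ norm z) :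
    ∃ w z', z = w * z' ∧ norm w < norm z ∧ norm z' < norm z ∧
      w⁻¹ * u * w = u ∧ z'⁻¹ * u * z' = z⁻¹ * u * z := by
  obtain ⟨i, j, hij, hj, heq⟩ := exists_lt_eq_of_norm_le
    (fun j => (wordPrefix z j)⁻¹ * u * wordPrefix z j)
    (fun j hj => norm_inv_wordPrefix_mul_mul_wordPrefix_le u z (by omega)) le_rfl
  refine ⟨wordPrefix z j * (wordPrefix z i)⁻¹, wordPrefix z i * (wordPrefix z j)⁻¹ * z, by group,
    norm_wordPrefix_mul_inv_lt hij (by omega), norm_wordPrefix_mul_inv_mul_lt hij (by omega),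
    ?_, ?_⟩
  · calc _ = wordPrefix z i * ((wordPrefix z j)⁻¹ * u * wordPrefix z j) * (wordPrefix z i)⁻¹ := by
          group
      _ = u := by rw [← heq]; group
  · calc _ = z⁻¹ * wordPrefix z j * ((wordPrefix z i)⁻¹ * u * wordPrefix z i) *
          (wordPrefix z j)⁻¹ * z := by group
      _ = z⁻¹ * u * z := by rw [heq]; group

theorem exists_conj_eq_norm_le [Fintype α] {u v z : FreeGroup α} (h : z⁻¹ * u * z = v) :
    ∃ z', z'⁻¹ * u * z' = v ∧ norm z' ≤ 2 * ballBound α (3 * (norm u + norm v)) := by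
  induction hn : norm z using Nat.strong_induction_on generalizing z with
  | _ n ih =>
    rcases le_total (norm z) (2 * ballBound α (3 * (norm u + norm v))) with hle | hle
    · exact ⟨z, h, hle⟩
    · obtain ⟨-, z', -, -, hlt, -, hz'⟩ := exists_eq_mul_of_le_norm_conjugator u z (by rwa [h])
      exact ih _ (hn ▸ hlt) (hz'.trans h) rfl

/-- Every prefix of `g⁻¹ u g` lies on one of the three segments of the path spelled by `g⁻¹ u g`;
when `g` is a shortest element of `g S`, it stays `K`-close to the ends on the outer segments. -/
lemma norm_conj_le_of_minimal {S : Subgroup (FreeGroup α)} {K : ℕ}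
    (hK : ∀ s ∈ S, ∀ j, ∃ t ∈ S, norm ((wordPrefix s j)⁻¹ * t) ≤ K) {u g : FreeGroup α}
    (hg : g⁻¹ * u * g ∈ S) (hmin : ∀ s ∈ S, norm g ≤ norm (g * s)) :
    norm (g⁻¹ * u * g) ≤ 3 * norm u + 2 * K + 1 := by
  have hnear : ∀ s ∈ S, ∀ j, norm g ≤ norm (g * s * wordPrefix (g⁻¹ * u * g) j) + K := by
    intro s hs j
    obtain ⟨t, ht, hle⟩ := hK _ hg j
    have h₁ := hmin _ (mul_mem hs ht)
    have h₂ := norm_mul_le (g * s * wordPrefix (g⁻¹ * u * g) j)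
      ((wordPrefix (g⁻¹ * u * g) j)⁻¹ * t)
    rw [mul_assoc _ (wordPrefix _ _), mul_inv_cancel_left, mul_assoc g] at h₂
    omega
  have hone := hnear 1 (one_mem S) (K + 1)
  have hinv := hnear _ (inv_mem hg) (K + 1)
  have hnorm := norm_wordPrefix (g⁻¹ * u * g) (K + 1)
  have hrest := norm_inv_wordPrefix_mul (g⁻¹ * u * g) (K + 1)
  have htotal := (norm_mul_le (g⁻¹ * u) g).trans (Nat.add_le_add_right (norm_mul_le g⁻¹ u) _)
  rw [norm_inv_eq] at htotal
  rcases exists_wordPrefix_mul_eq (g⁻¹ * u) g (K + 1) with ⟨k, hk⟩ | ⟨k, hk⟩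
  · rcases exists_wordPrefix_mul_eq g⁻¹ u k with ⟨i, hi⟩ | ⟨i, hi⟩
    · have hsub : norm (g * wordPrefix g⁻¹ i) = norm g - i := by
        rw [← norm_inv_eq, mul_inv_rev, norm_inv_wordPrefix_mul, norm_inv_eq]
      rw [hk, hi, mul_one] at hone
      rw [hk, hi, norm_wordPrefix, norm_inv_eq] at hnorm
      omega
    · rw [hk, hi, mul_one, mul_inv_cancel_left, norm_wordPrefix] at hone
      omega
  · rw [hk, show g * (g⁻¹ * u * g)⁻¹ * (g⁻¹ * u * wordPrefix g k) = wordPrefix g k by group,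
      norm_wordPrefix] at hinv
    rw [hk, mul_inv_rev, mul_assoc, inv_mul_cancel_left, norm_inv_wordPrefix_mul] at hrest
    omega

theorem mem_of_forall_short_conj_mem [Fintype α] {S : Subgroup (FreeGroup α)} {K : ℕ}
    (hK : ∀ s ∈ S, ∀ j, ∃ t ∈ S, norm ((wordPrefix s j)⁻¹ * t) ≤ K) {u : FreeGroup α}
    (hu : ∀ g : FreeGroup α, norm g ≤ 2 * ballBound α (3 * (4 * norm u + 2 * K + 1)) →
      g⁻¹ * u * g ∈ S → g ∈ S) {g : FreeGroup α} (hg : g⁻¹ * u * g ∈ S) : g ∈ S := by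
  induction hn : norm g using Nat.strong_induction_on generalizing g with
  | _ n ih =>
    by_cases hmin : ∃ s ∈ S, norm (g * s) < norm g
    · obtain ⟨s, hs, hlt⟩ := hmin
      have hconj : (g * s)⁻¹ * u * (g * s) ∈ S := by
        rw [show (g * s)⁻¹ * u * (g * s) = s⁻¹ * (g⁻¹ * u * g) * s by group]
        exact mul_mem (mul_mem (inv_mem hs) hg) hs
      exact (Subgroup.mul_mem_cancel_right _ hs).1 (ih _ (hn ▸ hlt) hconj rfl)
    push Not at hmin
    have hshort := norm_conj_le_of_minimal hK hg hmin
    rcases le_total (norm g) (2 * ballBound α (3 * (4 * norm u + 2 * K + 1))) with hle | hle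
    · exact hu g hle hg
    · have hball : ballBound α (3 * (norm u + norm (g⁻¹ * u * g))) ≤
          ballBound α (3 * (4 * norm u + 2 * K + 1)) := ballBound_mono α (by omega)
      obtain ⟨w, z, rfl, hw, hz, hwu, hzu⟩ := exists_eq_mul_of_le_norm_conjugator u g (by omega)
      have hzmem : z ∈ S := ih _ (hn ▸ hz) (by rwa [hzu]) rfl
      have humem : u ∈ S := by
        rw [show u = z * (z⁻¹ * u * z) * z⁻¹ by group, hzu]
        exact mul_mem (mul_mem hzmem hg) (inv_mem hzmem)
      exact mul_mem (ih _ (hn ▸ hw) (by rwa [hwu]) rfl) hzmem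

end Pumping

section FreeSubgroups

open FreeGroup

variable {α ρ : Type*} [DecidableEq α] [DecidableEq ρ]

lemma finite_norm_le [Finite α] (n : ℕ) : {x : FreeGroup α | norm x ≤ n}.Finite :=
  (List.finite_length_le (α × Bool) n).preimage toWord_injective.injOn

lemma exists_norm_map_le [Finite ρ] (f : FreeGroup ρ →* FreeGroup α) :
    ∃ D, ∀ x, norm (f x) ≤ D * norm x := by
  obtain ⟨D, hD⟩ := (Set.finite_range fun a : ρ => norm (f (of a))).bddAbove
  have hword : ∀ L : List (ρ × Bool), norm (f (mk L)) ≤ D * L.length := by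
    intro L
    induction L with
    | nil => simp [← one_eq_mk]
    | cons a L ih =>
      have hletter : norm (f (mk [a])) ≤ D := by
        obtain ⟨a, _ | _⟩ := a
        · rw [← norm_inv_eq, ← _root_.map_inv, inv_mk]
          exact hD ⟨a, rfl⟩
        · exact hD ⟨a, rfl⟩
      have hmul := norm_mul_le (f (mk [a])) (f (mk L))
      rw [← _root_.map_mul, mul_mk, List.singleton_append] at hmul
      rw [List.length_cons, Nat.mul_succ]
      omega
  exact ⟨D, fun x => by simpa only [mk_toWord, norm.eq_1] using hword x.toWord⟩

theorem exists_norm_inv_wordPrefix_mul_map_le [Finite ρ] (f : FreeGroup ρ →* FreeGroup α) :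
    ∃ K, ∀ x j, ∃ i, norm ((wordPrefix (f x) j)⁻¹ * f (wordPrefix x i)) ≤ K := by
  obtain ⟨D, hD⟩ := exists_norm_map_le f
  refine ⟨D, fun x j => ?_⟩
  obtain ⟨i, -, hi⟩ := exists_norm_inv_wordPrefix_mul_le (fun i => f (wordPrefix x i)) (by simp)
    (M := D) (norm x) (fun i _ => by
      rw [← _root_.map_inv, ← _root_.map_mul]
      refine (hD _).trans ?_
      simpa using Nat.mul_le_mul_left D (norm_inv_wordPrefix_mul_wordPrefix_succ_le x i)) j
  exact ⟨i, by simpa using hi⟩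

lemma exists_norm_le_of_norm_map_le [Finite α] {f : FreeGroup ρ →* FreeGroup α}
    (hf : Function.Injective f) (n : ℕ) : ∃ K, ∀ x, norm (f x) ≤ n → norm x ≤ K := by
  obtain ⟨K, hK⟩ := (((finite_norm_le n).preimage hf.injOn).image FreeGroup.norm).bddAbove
  exact ⟨K, fun x hx => hK ⟨x, hx, rfl⟩⟩

/-- Following the geodesic from `1` to `f x` inside the image of `f` gives a path from `1` to `x`
with bounded jumps. -/
lemma exists_path_along_map [Finite α] [Finite ρ] {f : FreeGroup ρ →* FreeGroup α}
    (hf : Function.Injective f) : ∃ K, ∀ x, ∃ w : ℕ → FreeGroup ρ,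
      w 0 = 1 ∧ w (norm (f x)) = x ∧ (∀ j, norm ((w j)⁻¹ * w (j + 1)) ≤ K) ∧
        ∀ j, norm ((wordPrefix (f x) j)⁻¹ * f (w j)) ≤ K := by
  obtain ⟨D, hD⟩ := exists_norm_inv_wordPrefix_mul_map_le f
  obtain ⟨K, hK⟩ := exists_norm_le_of_norm_map_le hf (2 * D + 1)
  refine ⟨max D K, fun x => ?_⟩
  have hnear : ∀ j, ∃ y : FreeGroup ρ, norm ((wordPrefix (f x) j)⁻¹ * f y) ≤ D ∧
      (j = 0 → y = 1) ∧ (j = norm (f x) → y = x) := by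
    intro j
    rcases eq_or_ne j (norm (f x)) with rfl | hx
    · refine ⟨x, by simp, fun h => hf ?_, fun _ => rfl⟩
      rw [FreeGroup.norm_eq_zero.1 h, _root_.map_one]
    rcases eq_or_ne j 0 with rfl | h0
    · exact ⟨1, by simp, fun _ => rfl, fun h => absurd h hx⟩
    · obtain ⟨i, hi⟩ := hD x j
      exact ⟨wordPrefix x i, hi, fun h => absurd h h0, fun h => absurd h hx⟩
  choose w hw h0 hx using hnear
  refine ⟨w, h0 0 rfl, hx _ rfl, fun j => le_max_of_le_right (hK _ ?_),
    fun j => le_max_of_le_left (hw j)⟩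
  have hstart := hw j
  have hend := hw (j + 1)
  have hstep := norm_inv_wordPrefix_mul_wordPrefix_succ_le (f x) j
  have hleft := norm_inv_mul_le (f (w j)) (wordPrefix (f x) j) (f (w (j + 1)))
  have hright := norm_inv_mul_le (wordPrefix (f x) j) (wordPrefix (f x) (j + 1)) (f (w (j + 1)))
  rw [norm_inv_mul_comm (f (w j)) (wordPrefix (f x) j)] at hleft
  rw [_root_.map_mul, _root_.map_inv]
  omega

theorem exists_norm_le_mul_norm_map [Finite α] [Finite ρ] {f : FreeGroup ρ →* FreeGroup α}
    (hf : Function.Injective f) : ∃ K, ∀ x, FreeGroup.norm x ≤ K * norm (f x) := by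
  obtain ⟨K, hK⟩ := exists_path_along_map hf
  refine ⟨K, fun x => ?_⟩
  obtain ⟨w, h0, hx, hjump, -⟩ := hK x
  have hpath : ∀ j, norm (w j) ≤ K * j := by
    intro j
    induction j with
    | zero => simp [h0]
    | succ j ih =>
      have hmul := norm_mul_le (w j) ((w j)⁻¹ * w (j + 1))
      rw [mul_inv_cancel_left] at hmul
      have := hjump j
      rw [Nat.mul_succ]
      omega
  simpa [hx] using hpath (norm (f x))

theorem exists_norm_inv_map_wordPrefix_mul_le [Finite α] [Finite ρ]
    {f : FreeGroup ρ →* FreeGroup α} (hf : Function.Injective f) :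
    ∃ K, ∀ x j, ∃ i, norm ((f (wordPrefix x j))⁻¹ * wordPrefix (f x) i) ≤ K := by
  obtain ⟨K, hK⟩ := exists_path_along_map hf
  obtain ⟨D, hD⟩ := exists_norm_map_le f
  refine ⟨D * K + K, fun x j => ?_⟩
  obtain ⟨w, h0, hx, hjump, hnear⟩ := hK x
  obtain ⟨i, -, hi⟩ := exists_norm_inv_wordPrefix_mul_le w h0 (norm (f x)) (fun i _ => hjump i) j
  rw [hx] at hi
  refine ⟨i, ?_⟩
  have hmap := (hD _).trans (Nat.mul_le_mul_left D hi)
  rw [_root_.map_mul, _root_.map_inv] at hmap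
  have hmul := norm_inv_mul_le (f (wordPrefix x j)) (f (w i)) (wordPrefix (f x) i)
  have := hnear i
  rw [norm_inv_mul_comm] at this
  omega

/-- Opposite sides of the quadrilateral `1, g, g (f d) = (f c) h, f c` stay close to each other,
also when they are followed inside the image of `f`. -/
theorem exists_norm_inv_map_wordPrefix_mul_mul_le [Finite α] [Finite ρ]
    {f : FreeGroup ρ →* FreeGroup α} (hf : Function.Injective f) :
    ∃ K, ∀ {g h : FreeGroup α} {c d : FreeGroup ρ}, f d = g⁻¹ * f c * h → ∀ j, ∃ i,
      norm ((f (wordPrefix c j))⁻¹ * g * f (wordPrefix d i)) ≤ K + max (norm g) (norm h) := by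
  obtain ⟨K, hK⟩ := exists_norm_inv_map_wordPrefix_mul_le hf
  obtain ⟨L, hL⟩ := exists_norm_inv_wordPrefix_mul_map_le f
  refine ⟨K + L, fun {g h c d} hd j => ?_⟩
  obtain ⟨i, hi⟩ := hK c j
  obtain ⟨k, -, hk⟩ := exists_norm_inv_wordPrefix_mul_mul_le hd i
  obtain ⟨l, hl⟩ := hL d k
  refine ⟨l, ?_⟩
  have hfirst := norm_mul_le ((f (wordPrefix c j))⁻¹ * wordPrefix (f c) i)
    ((wordPrefix (f c) i)⁻¹ * g * wordPrefix (f d) k)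
  have hsecond := norm_mul_le ((f (wordPrefix c j))⁻¹ * g * wordPrefix (f d) k)
    ((wordPrefix (f d) k)⁻¹ * f (wordPrefix d l))
  simp only [mul_assoc, mul_inv_cancel_left] at *
  omega

/-- A finitely generated group has finitely many homomorphisms to a group of order two. -/
theorem finite_of_fg_freeGroup {X : Type*} [Group.FG (FreeGroup X)] : Finite X := by
  classical
  obtain ⟨S, hS⟩ := Group.FG.out (G := FreeGroup X)
  have hinj : Function.Injective fun (f : X → ℤˣ) (s : S) => FreeGroup.lift f s := fun f g h =>
    FreeGroup.lift.injective (MonoidHom.eq_of_eqOn_dense hS fun s hs => congrFun h ⟨s, hs⟩)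
  have := Finite.of_injective _ hinj
  exact Finite.of_injective (fun x : X => Pi.mulSingle x (-1 : ℤˣ)) fun x y h => by
    by_contra hxy
    simpa [Pi.mulSingle_apply, hxy] using congrFun h x

theorem exists_freeGroupBasis_fin_of_injective {X : Type*} {C : Type*} [Group C] [Group.FG C]
    {f : C →* FreeGroup X} (hf : Function.Injective f) :
    ∃ r, Nonempty (FreeGroupBasis (Fin r) C) := by
  have := IsFreeGroup.ofMulEquiv (MonoidHom.ofInjective hf).symm
  have := Group.fg_of_surjective (f := (IsFreeGroup.toFreeGroup C).toMonoidHom)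
    (IsFreeGroup.toFreeGroup C).surjective
  have : Finite (IsFreeGroup.Generators C) := finite_of_fg_freeGroup
  exact ⟨_, ⟨(IsFreeGroup.basis C).reindex (Finite.equivFin _)⟩⟩

end FreeSubgroups

section WordBalls

variable {Y G : Type*} [Group G] {γ : Y → G}

@[simp] lemma GroupWord.eval_nil : GroupWord.eval γ [] = 1 := rfl

@[simp] lemma GroupWord.eval_append (w w' : GroupWord Y) :
    GroupWord.eval γ (w ++ w') = w.eval γ * w'.eval γ := by
  rw [eval, ← FreeGroup.mul_mk, map_mul, eval, eval]

@[simp] lemma GroupWord.eval_invRev (w : GroupWord Y) :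
    GroupWord.eval γ (FreeGroup.invRev w) = (w.eval γ)⁻¹ := by
  rw [eval, ← FreeGroup.inv_mk, map_inv, eval]

/-- The ball of radius `N` about `1` in the word metric of the generators `γ`. -/
def wordBall (γ : Y → G) (N : ℕ) : Set G := {g | ∃ w : GroupWord Y, w.length ≤ N ∧ w.eval γ = g}

lemma wordBall_mono {N N' : ℕ} (h : N ≤ N') : wordBall γ N ⊆ wordBall γ N' :=
  fun _ ⟨w, hw, heq⟩ => ⟨w, hw.trans h, heq⟩

lemma one_mem_wordBall (N : ℕ) : 1 ∈ wordBall γ N := ⟨[], Nat.zero_le N, rfl⟩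

lemma mul_mem_wordBall {g h : G} {N N' : ℕ} (hg : g ∈ wordBall γ N) (hh : h ∈ wordBall γ N') :
    g * h ∈ wordBall γ (N + N') := by
  obtain ⟨w, hw, rfl⟩ := hg
  obtain ⟨w', hw', rfl⟩ := hh
  exact ⟨w ++ w', by rw [List.length_append]; omega, by simp⟩

lemma inv_mem_wordBall {g : G} {N : ℕ} (hg : g ∈ wordBall γ N) : g⁻¹ ∈ wordBall γ N := by
  obtain ⟨w, hw, rfl⟩ := hg
  exact ⟨FreeGroup.invRev w, by simpa, by simp⟩

lemma exists_lt_eq_of_mem_wordBall [Fintype Y] {k : ℕ} {f : ℕ → G}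
    (hf : ∀ j, f j ∈ wordBall γ k) : ∃ i j, i < j ∧ j ≤ ballBound Y k ∧ f i = f j := by
  choose w hw heq using hf
  obtain ⟨i, j, hij, hj, hwij⟩ := exists_lt_eq_of_length_le w (fun j _ => hw j)
    (J := ballBound Y k) (by simp [ballBound, mul_comm])
  exact ⟨i, j, hij, hj, by rw [← heq, ← heq, hwij]⟩

end WordBalls

section Bases

variable {X F : Type*} [Group F] (b : FreeGroupBasis X F)

@[simp] lemma repr_eval_basis (w : GroupWord X) : b.repr (w.eval b) = FreeGroup.mk w := by
  have hhom : b.repr.toMonoidHom.comp (FreeGroup.lift b) = MonoidHom.id (FreeGroup X) :=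
    FreeGroup.ext_hom _ _ (by simp)
  exact DFunLike.congr_fun hhom (FreeGroup.mk w)

variable [DecidableEq X]

/-- The word length of an element of a free group with respect to a basis. -/
def basisLength (g : F) : ℕ := FreeGroup.norm (b.repr g)

/-- The element represented by the first `j` letters of the reduced word of `g` in a basis. -/
def basisPrefix (g : F) (j : ℕ) : F := b.repr.symm (wordPrefix (b.repr g) j)

lemma basisLength_mul_le (g h : F) : basisLength b (g * h) ≤ basisLength b g + basisLength b h := by
  simpa only [basisLength, map_mul] using FreeGroup.norm_mul_le (b.repr g) (b.repr h)

lemma basisLength_eval_le (w : GroupWord X) : basisLength b (w.eval b) ≤ w.length := by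
  rw [basisLength, repr_eval_basis]
  exact FreeGroup.norm_mk_le

lemma eval_toWord_repr (g : F) : GroupWord.eval b (b.repr g).toWord = g :=
  b.repr.injective (by rw [repr_eval_basis, FreeGroup.mk_toWord])

lemma basisLength_basisPrefix_mul_inv_lt {g : F} {i j : ℕ} (hij : i < j)
    (hj : 2 * j ≤ basisLength b g) :
    basisLength b (basisPrefix b g j * (basisPrefix b g i)⁻¹) < basisLength b g := by
  simpa [basisLength, basisPrefix] using norm_wordPrefix_mul_inv_lt hij hj

lemma basisLength_basisPrefix_mul_inv_mul_lt {g : F} {i j : ℕ} (hij : i < j)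
    (hj : j ≤ basisLength b g) :
    basisLength b (basisPrefix b g i * (basisPrefix b g j)⁻¹ * g) < basisLength b g := by
  simpa [basisLength, basisPrefix] using norm_wordPrefix_mul_inv_mul_lt hij hj

variable {b}

theorem exists_conj_eq_basisLength_le [Fintype X] {u v z : F} (h : z⁻¹ * u * z = v) :
    ∃ z', z'⁻¹ * u * z' = v ∧
      basisLength b z' ≤ 2 * ballBound X (3 * (basisLength b u + basisLength b v)) := by
  obtain ⟨z', hz', hle⟩ := exists_conj_eq_norm_le (u := b.repr u) (v := b.repr v) (z := b.repr z)
    (by simp [← h])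
  exact ⟨b.repr.symm z', b.repr.injective (by simpa using hz'), by simpa [basisLength] using hle⟩

/-- `κ` bounds the distortion of distances along the image of a homomorphism of free groups: the
image is `κ`-quasiconvex, opposite sides of a quadrilateral `1, g, g (f d) = (f c) h, f c` stay
close, and `f` is `κ`-bi-Lipschitz. -/
structure IsQuasiconvexBound {ρ H : Type*} [DecidableEq ρ] [Group H] (b : FreeGroupBasis X F)
    (β : FreeGroupBasis ρ H) (f : H →* F) (κ : ℕ) : Prop where
  exists_near : ∀ s ∈ f.range, ∀ j, ∃ t ∈ f.range, basisLength b ((basisPrefix b s j)⁻¹ * t) ≤ κ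
  exists_across : ∀ {g h : F} {c d : H}, f d = g⁻¹ * f c * h → ∀ j, ∃ i,
    basisLength b ((f (basisPrefix β c j))⁻¹ * g * f (basisPrefix β d i)) ≤
      κ + max (basisLength b g) (basisLength b h)
  length_map_le : ∀ c, basisLength b (f c) ≤ κ * basisLength β c
  length_le_map : ∀ c, basisLength β c ≤ κ * basisLength b (f c)

variable {ρ H : Type*} [DecidableEq ρ] [Group H] {β : FreeGroupBasis ρ H} {f : H →* F} {κ : ℕ}

lemma IsQuasiconvexBound.mono {κ' : ℕ} (h : IsQuasiconvexBound b β f κ) (hle : κ ≤ κ') :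
    IsQuasiconvexBound b β f κ' where
  exists_near s hs j := (h.exists_near s hs j).imp fun _ ht => ⟨ht.1, ht.2.trans hle⟩
  exists_across hd j := (h.exists_across hd j).imp fun _ hi => hi.trans (by gcongr)
  length_map_le c := (h.length_map_le c).trans (by gcongr)
  length_le_map c := (h.length_le_map c).trans (by gcongr)

theorem exists_isQuasiconvexBound [Finite X] [Finite ρ] (hf : Function.Injective f) :
    ∃ κ, IsQuasiconvexBound b β f κ := by
  let f' : FreeGroup ρ →* FreeGroup X :=
    b.repr.toMonoidHom.comp (f.comp β.repr.symm.toMonoidHom)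
  have hf' : Function.Injective f' := b.repr.injective.comp (hf.comp β.repr.symm.injective)
  have hf'_apply (x : FreeGroup ρ) : f' x = b.repr (f (β.repr.symm x)) := rfl
  obtain ⟨K₁, hK₁⟩ := exists_norm_inv_wordPrefix_mul_map_le f'
  obtain ⟨K₂, hK₂⟩ := exists_norm_inv_map_wordPrefix_mul_mul_le hf'
  obtain ⟨K₃, hK₃⟩ := exists_norm_map_le f'
  obtain ⟨K₄, hK₄⟩ := exists_norm_le_mul_norm_map hf'
  refine ⟨K₁ + K₂ + K₃ + K₄, ?_, ?_, ?_, ?_⟩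
  · rintro _ ⟨c, rfl⟩ j
    obtain ⟨i, hi⟩ := hK₁ (β.repr c) j
    refine ⟨f (basisPrefix β c i), ⟨_, rfl⟩, le_trans ?_ (by omega : K₁ ≤ _)⟩
    simpa [basisLength, basisPrefix, hf'_apply] using hi
  · intro g h c d hd j
    obtain ⟨i, hi⟩ := hK₂ (g := b.repr g) (h := b.repr h) (c := β.repr c) (d := β.repr d)
      (by simp [hf'_apply, hd]) j
    refine ⟨i, le_trans ?_ (by simp only [basisLength]; omega :
      K₂ + max (FreeGroup.norm (b.repr g)) (FreeGroup.norm (b.repr h)) ≤ _)⟩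
    simpa [basisLength, basisPrefix, hf'_apply] using hi
  · intro c
    refine le_trans ?_ (Nat.mul_le_mul_right _ (by omega : K₃ ≤ _))
    simpa [basisLength, hf'_apply] using hK₃ (β.repr c)
  · intro c
    refine le_trans ?_ (Nat.mul_le_mul_right _ (by omega : K₄ ≤ _))
    simpa [basisLength, hf'_apply] using hK₄ (β.repr c)

theorem IsQuasiconvexBound.mem_range_of_forall_short_conj_mem [Fintype X]
    (hκ : IsQuasiconvexBound b β f κ) {u g : F}
    (hu : ∀ g, basisLength b g ≤ 2 * ballBound X (3 * (4 * basisLength b u + 2 * κ + 1)) →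
      g⁻¹ * u * g ∈ f.range → g ∈ f.range) (hg : g⁻¹ * u * g ∈ f.range) : g ∈ f.range := by
  have hmem (x : FreeGroup X) : x ∈ f.range.map b.repr.toMonoidHom ↔ b.repr.symm x ∈ f.range :=
    Subgroup.mem_map_equiv
  have := mem_of_forall_short_conj_mem (S := f.range.map b.repr.toMonoidHom) (K := κ)
    (u := b.repr u) (g := b.repr g) ?_ ?_
    ((hmem _).2 (by simpa only [map_mul, map_inv, MulEquiv.symm_apply_apply] using hg))
  · simpa [hmem] using this
  · rintro s hs j
    obtain ⟨t, ht, hle⟩ := hκ.exists_near _ ((hmem s).1 hs) j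
    exact ⟨b.repr t, by simpa [hmem] using ht, by simpa [basisLength, basisPrefix] using hle⟩
  · intro x hx hconj
    refine (hmem x).2 (hu _ (by simpa [basisLength] using hx) ?_)
    simpa only [map_mul, map_inv, MulEquiv.symm_apply_apply] using (hmem _).1 hconj

end Bases

section ShortConjugators

namespace Syllables

section

variable {ι : Type*} {M : ι → Type*} [∀ i, Group (M i)] {H : Type*} [Group H] {θ : ∀ i, H →* M i}

lemma exists_map_eq_of_base_mul_prod_eq (hθ : ∀ i, Function.Injective (θ i)) {i : ι} {g h : M i}
    {t t' : Syllables M} (hl : IsReduced θ (⟨i, g⟩ :: t)) (hl' : IsReduced θ (⟨i, h⟩ :: t'))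
    {c e : H} (heq : PushoutI.base θ c * prod θ (⟨i, h⟩ :: t') =
      prod θ (⟨i, g⟩ :: t) * PushoutI.base θ e) :
    ∃ d, θ i d = g⁻¹ * θ i c * h ∧
      PushoutI.base θ d * prod θ t' = prod θ t * PushoutI.base θ e := by
  have htail : PushoutI.of i (g⁻¹ * θ i c * h) * prod θ t' = prod θ t * PushoutI.base θ e := by
    rw [prod_cons, prod_cons, mul_assoc, ← inv_mul_eq_iff_eq_mul] at heq
    simpa [PushoutI.of_apply_eq_base, mul_assoc] using heq
  obtain ⟨-, ht, hit⟩ := isReduced_cons_iff.1 hl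
  obtain ⟨-, ht', hit'⟩ := isReduced_cons_iff.1 hl'
  obtain ⟨d, hd⟩ : g⁻¹ * θ i c * h ∈ (θ i).range := by
    by_contra hmem
    have hind := indices_eq_of_base_mul_prod_eq hθ (isReduced_cons_iff.2 ⟨hmem, ht', hit'⟩) ht
      (a := 1) (b := 1) (c := 1) (d := e) (by simpa using htail)
    exact hit i (by simp [← hind]) rfl
  exact ⟨d, hd, by rwa [← hd, PushoutI.of_apply_eq_base] at htail⟩

end

end Syllables

section

variable {ι : Type*} {M : ι → Type*} [∀ i, Group (M i)] {H : Type*} [Group H]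
  {Y : Type*} [DecidableEq Y] {side : Y → ι}

open Syllables

/-- The generators of an amalgamated product given by bases of its factors. The letters form one
alphabet, and `side` tells to which factor a letter belongs. -/
def amalgamGen (θ : ∀ i, H →* M i) (b : ∀ i, FreeGroupBasis {y // side y = i} (M i)) (y : Y) :
    PushoutI θ := PushoutI.of (side y) (b (side y) ⟨y, rfl⟩)

/-- The word over the whole alphabet given by the reduced word of `g` in the basis of `M i`. -/
def factorWord (b : ∀ i, FreeGroupBasis {y // side y = i} (M i)) (i : ι) (g : M i) : GroupWord Y :=
  ((b i).repr g).toWord.map fun x => (x.1.1, x.2)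

/-- The total length of the syllables in the given bases of the factors, each syllable being
counted with one extra unit. -/
def sylSize (b : ∀ i, FreeGroupBasis {y // side y = i} (M i)) (l : Syllables M) : ℕ :=
  (l.map fun s => basisLength (b s.1) s.2 + 1).sum

/-- `g` has a reduced form of size at most `N`; the coefficient in the amalgamated subgroup is
measured in every factor. -/
def HasSize (θ : ∀ i, H →* M i) (b : ∀ i, FreeGroupBasis {y // side y = i} (M i)) (g : PushoutI θ)
    (N : ℕ) : Prop :=
  ∃ c l, IsReduced θ l ∧ g = PushoutI.base θ c * prod θ l ∧
    ∀ i, basisLength (b i) (θ i c) + sylSize b l ≤ N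

variable {θ : ∀ i, H →* M i} {b : ∀ i, FreeGroupBasis {y // side y = i} (M i)}

lemma eval_factorWord {G : Type*} [Group G] {γ : Y → G} {i : ι} (g : M i) (f : M i →* G)
    (hf : ∀ y, γ y.1 = f (b i y)) : (factorWord b i g).eval γ = f g := by
  have hhom : (FreeGroup.lift γ).comp (FreeGroup.map Subtype.val) =
      f.comp (b i).repr.symm.toMonoidHom :=
    FreeGroup.ext_hom _ _ fun y => by
      rw [MonoidHom.comp_apply, FreeGroup.map.of, FreeGroup.lift_apply_of]
      exact hf y
  have := DFunLike.congr_fun hhom (FreeGroup.mk ((b i).repr g).toWord)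
  rw [MonoidHom.comp_apply, FreeGroup.map.mk] at this
  simpa [GroupWord.eval, factorWord, FreeGroup.mk_toWord] using this

@[simp] lemma sylSize_cons (s : Σ i, M i) (l : Syllables M) :
    sylSize b (s :: l) = basisLength (b s.1) s.2 + 1 + sylSize b l := List.sum_cons

@[simp] lemma sylSize_append (l l' : Syllables M) :
    sylSize b (l ++ l') = sylSize b l + sylSize b l' := by
  simp [sylSize]

lemma length_le_sylSize (l : Syllables M) : l.length ≤ sylSize b l := by
  induction l with
  | nil => exact Nat.zero_le _
  | cons s l ih =>
    rw [List.length_cons, sylSize_cons]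
    omega

lemma basisLength_le_sylSize {l : Syllables M} {s : Σ i, M i} (hs : s ∈ l) :
    basisLength (b s.1) s.2 ≤ sylSize b l :=
  (Nat.le_succ _).trans
    (List.le_sum_of_mem (List.mem_map_of_mem (f := fun s => basisLength (b s.1) s.2 + 1) hs))

lemma of_mem_wordBall {i : ι} (g : M i) :
    PushoutI.of i g ∈ wordBall (amalgamGen θ b) (basisLength (b i) g) := by
  refine ⟨factorWord b i g, (List.length_map _).le,
    eval_factorWord g (PushoutI.of (φ := θ) i) ?_⟩
  rintro ⟨y, rfl⟩
  rfl

lemma prod_mem_wordBall (l : Syllables M) :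
    prod θ l ∈ wordBall (amalgamGen θ b) (sylSize b l) := by
  induction l with
  | nil => exact one_mem_wordBall _
  | cons s l ih =>
    rw [prod_cons, sylSize_cons]
    exact mul_mem_wordBall (wordBall_mono (Nat.le_succ _) (of_mem_wordBall s.2)) ih

lemma exists_mem_wordBall_conj_prod_eq_of_isRotated {l l₁ : Syllables M} (h : l ~r l₁) :
    ∃ w ∈ wordBall (amalgamGen θ b) (sylSize b l), w⁻¹ * prod θ l * w = prod θ l₁ := by
  obtain ⟨k, hk, rfl⟩ := List.isRotated_iff_mod.1 h
  have hsize : sylSize b (l.take k) ≤ sylSize b l := by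
    conv_rhs => rw [← List.take_append_drop k l, sylSize_append]
    exact Nat.le_add_right _ _
  have hprod : prod θ l = prod θ (l.take k) * prod θ (l.drop k) := by
    rw [← prod_append, List.take_append_drop]
  refine ⟨prod θ (l.take k), wordBall_mono hsize (prod_mem_wordBall _), ?_⟩
  rw [List.rotate_eq_drop_append_take hk, prod_append, hprod, inv_mul_cancel_left]

lemma HasSize.exists_prod_eq {g : PushoutI θ} {N : ℕ} (hg : HasSize θ b g N)
    (hmem : g ∉ (PushoutI.base θ).range) :
    ∃ l, IsReduced θ l ∧ prod θ l = g ∧ sylSize b l ≤ N := by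
  obtain ⟨c, l, hl, rfl, hN⟩ := hg
  rcases l with _ | ⟨⟨i, x⟩, t⟩
  · exact absurd ⟨c, by simp⟩ hmem
  refine ⟨⟨i, θ i c * x⟩ :: t, ?_, by simp [← mul_assoc, base_mul_of], ?_⟩
  · rw [isReduced_cons_iff] at hl ⊢
    rwa [Subgroup.mul_mem_cancel_left _ (MonoidHom.mem_range.2 ⟨c, rfl⟩)]
  · have hmul := basisLength_mul_le (b i) (θ i c) x
    have := hN i
    simp only [sylSize_cons] at this ⊢
    omega

lemma HasSize.basisLength_le (hθ : ∀ i, Function.Injective (θ i)) {i : ι} {a : M i} {N : ℕ}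
    (h : HasSize θ b (PushoutI.of i a) N) : basisLength (b i) a ≤ N := by
  by_cases ha : PushoutI.of i a ∈ (PushoutI.base θ).range
  · obtain ⟨c, l, hl, heq, hN⟩ := h
    have hnil : l = [] := by
      rw [← indices_eq_nil, ← hl.factorSeq_base_mul hθ c, ← heq]
      exact (factorSeq_eq_nil_iff hθ).2 ha
    rw [hnil, prod_nil, mul_one, ← PushoutI.of_apply_eq_base θ i] at heq
    rw [PushoutI.of_injective hθ i heq]
    exact (Nat.le_add_right _ _).trans (hN i)
  · obtain ⟨l, hl, heq, hN⟩ := h.exists_prod_eq ha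
    have hind : l.indices = [i] := by
      rw [← hl.factorSeq_prod hθ, heq]
      simpa using (isReduced_singleton (mt (of_mem_base_range hθ).2 ha)).factorSeq_prod hθ
    obtain ⟨⟨j, g⟩, rfl⟩ : ∃ s, l = [s] := by
      rw [← List.length_eq_one_iff, ← length_indices, hind, List.length_singleton]
    obtain rfl : j = i := by simpa using hind
    rw [prod_cons, prod_nil, mul_one] at heq
    rw [← PushoutI.of_injective hθ j heq]
    exact (basisLength_le_sylSize (List.mem_singleton_self _)).trans hN

variable {ρ : Type*} [DecidableEq ρ] {β : FreeGroupBasis ρ H} {κ : ℕ}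

lemma base_mem_wordBall (hκ : ∀ i, IsQuasiconvexBound (b i) β (θ i) κ) (i : ι) (c : H) :
    PushoutI.base θ c ∈ wordBall (amalgamGen θ b) (κ * basisLength β c) := by
  rw [← PushoutI.of_apply_eq_base θ i]
  exact wordBall_mono ((hκ i).length_map_le c) (of_mem_wordBall _)

/-- If `c (prod l') = (prod l) e`, then the path from `1` to `c` inside the amalgamated subgroup
stays close to its translate by `prod l`. -/
theorem exists_mem_wordBall_of_base_mul_prod_eq (hθ : ∀ i, Function.Injective (θ i))
    (hκ : ∀ i, IsQuasiconvexBound (b i) β (θ i) κ) {L : ℕ} {l l' : Syllables M}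
    (hl : IsReduced θ l) (hl' : IsReduced θ l') (hL : ∀ s ∈ l, basisLength (b s.1) s.2 ≤ L)
    (hL' : ∀ s ∈ l', basisLength (b s.1) s.2 ≤ L) {c e : H}
    (heq : PushoutI.base θ c * prod θ l' = prod θ l * PushoutI.base θ e) (j : ℕ) :
    ∃ d, (PushoutI.base θ (basisPrefix β c j))⁻¹ * prod θ l * PushoutI.base θ d ∈
      wordBall (amalgamGen θ b) (l.length * (κ + L)) := by
  induction l generalizing l' c j with
  | nil => exact ⟨basisPrefix β c j, by simpa using one_mem_wordBall _⟩
  | cons s t ih =>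
    have hind := indices_eq_of_base_mul_prod_eq hθ hl' hl (a := c) (b := 1) (c := 1) (d := e)
      (by simpa using heq)
    obtain ⟨s', t', rfl⟩ := List.exists_cons_of_ne_nil (l := l') (by rintro rfl; simp at hind)
    obtain ⟨i, g⟩ := s
    obtain ⟨i', h⟩ := s'
    obtain rfl : i' = i := (List.cons.inj hind).1
    obtain ⟨d, hd, htail⟩ := exists_map_eq_of_base_mul_prod_eq hθ hl hl' heq
    obtain ⟨k, hk⟩ := (hκ _).exists_across hd j
    obtain ⟨d', hd'⟩ := ih (isReduced_cons_iff.1 hl).2.1 (isReduced_cons_iff.1 hl').2.1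
      (fun s hs => hL s (List.mem_cons_of_mem _ hs)) (fun s hs => hL' s (List.mem_cons_of_mem _ hs))
      htail k
    have hsyl := max_le (hL _ List.mem_cons_self) (hL' _ List.mem_cons_self)
    have hstep := wordBall_mono (hk.trans (Nat.add_le_add_left hsyl κ))
      (of_mem_wordBall (θ := θ) (b := b) _)
    refine ⟨d', ?_⟩
    rw [List.length_cons, Nat.succ_mul, add_comm]
    simpa [PushoutI.of_apply_eq_base, mul_assoc] using mul_mem_wordBall hstep hd'

variable [Fintype Y]

lemma exists_basisLength_lt_of_base_mul_prod_eq (hθ : ∀ i, Function.Injective (θ i))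
    (hκ : ∀ i, IsQuasiconvexBound (b i) β (θ i) κ) {L : ℕ} {l l' : Syllables M}
    (hl : IsReduced θ l) (hl' : IsReduced θ l') (hL : ∀ s ∈ l, basisLength (b s.1) s.2 ≤ L)
    (hL' : ∀ s ∈ l', basisLength (b s.1) s.2 ≤ L) {c e : H}
    (heq : PushoutI.base θ c * prod θ l' = prod θ l * PushoutI.base θ e)
    (hlong : 2 * ballBound Y (l.length * (κ + L)) ≤ basisLength β c) :
    ∃ c' e', basisLength β c' < basisLength β c ∧ c' ≠ 1 ∧
      PushoutI.base θ c' * prod θ l' = prod θ l * PushoutI.base θ e' := by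
  choose d hd using exists_mem_wordBall_of_base_mul_prod_eq hθ hκ hl hl' hL hL' heq
  obtain ⟨i, j, hij, hj, hdij⟩ := exists_lt_eq_of_mem_wordBall hd
  set p := basisPrefix β c
  refine ⟨p i * (p j)⁻¹ * c, d i * (d j)⁻¹ * e,
    basisLength_basisPrefix_mul_inv_mul_lt β hij (by omega), fun hone => ?_, ?_⟩
  · have := basisLength_basisPrefix_mul_inv_lt β hij (by omega : 2 * j ≤ basisLength β c)
    rw [show p j * (p i)⁻¹ = c by simpa using (eq_inv_of_mul_eq_one_right hone).symm] at this
    exact lt_irrefl _ this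
  · have hshift : PushoutI.base θ (p i * (p j)⁻¹) * prod θ l =
        prod θ l * PushoutI.base θ (d i * (d j)⁻¹) := by
      have := congrArg (fun x => PushoutI.base θ (p i) * x * (PushoutI.base θ (d j))⁻¹) hdij
      simpa [mul_assoc] using this.symm
    rw [map_mul, mul_assoc, heq, ← mul_assoc, hshift, mul_assoc, ← map_mul]

theorem basisLength_le_of_base_mul_prod_eq (hθ : ∀ i, Function.Injective (θ i))
    (hκ : ∀ i, IsQuasiconvexBound (b i) β (θ i) κ) {L : ℕ} {l l' : Syllables M}
    (hl : IsReduced θ l) (hl' : IsReduced θ l') (hL : ∀ s ∈ l, basisLength (b s.1) s.2 ≤ L)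
    (hL' : ∀ s ∈ l', basisLength (b s.1) s.2 ≤ L)
    (hshort : ∀ c e, basisLength β c ≤ 2 * ballBound Y (l.length * (κ + L)) →
      PushoutI.base θ c * prod θ l = prod θ l * PushoutI.base θ e → c = 1) {c e : H}
    (heq : PushoutI.base θ c * prod θ l' = prod θ l * PushoutI.base θ e) :
    basisLength β c ≤ 2 * ballBound Y (l.length * (κ + L)) := by
  have htriv : ∀ c e, PushoutI.base θ c * prod θ l = prod θ l * PushoutI.base θ e → c = 1 := by
    intro c e h
    induction hn : basisLength β c using Nat.strong_induction_on generalizing c e with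
    | _ n ih =>
      by_contra hc
      obtain ⟨c', e', hlt, hne, h'⟩ := exists_basisLength_lt_of_base_mul_prod_eq hθ hκ hl hl hL hL
        h (not_le.1 fun hle => hc (hshort c e hle h)).le
      exact hne (ih _ (hn ▸ hlt) c' e' h' rfl)
  by_contra hlong
  obtain ⟨c', e', hlt, -, h'⟩ := exists_basisLength_lt_of_base_mul_prod_eq hθ hκ hl hl' hL hL'
    heq (not_le.1 hlong).le
  have hquot : c' * c⁻¹ = 1 := htriv _ (e' * e⁻¹) <| by
    have : prod θ l = PushoutI.base θ c * prod θ l' * (PushoutI.base θ e)⁻¹ := by simp [heq]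
    conv_lhs => rw [this]
    simp only [map_mul, map_inv, mul_assoc, inv_mul_cancel_left]
    rw [← mul_assoc, h', mul_assoc]
  rw [mul_inv_eq_one.1 hquot] at hlt
  exact lt_irrefl _ hlt

end

end ShortConjugators

section ConjugatorBound

/-- A bound for the word length of a conjugator of a regular element of size `N` to a cyclically
reduced element of size `N`. -/
def conjBound (Y : Type*) [Fintype Y] (κ N : ℕ) : ℕ :=
  N + (κ + 1) * (2 * ballBound Y (12 * (N + κ + 1) ^ 2))

lemma two_mul_ballBound_subtype_le_conjBound {Y : Type*} [Fintype Y] (p : Y → Prop)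
    [DecidablePred p] {k κ N : ℕ} (hk : k ≤ 12 * (N + κ + 1)) :
    2 * ballBound {y // p y} k ≤ conjBound Y κ N := by
  have hsub : ballBound {y // p y} k ≤ ballBound Y k :=
    Nat.pow_le_pow_left (Nat.succ_le_succ (Nat.mul_le_mul_left 2 (Fintype.card_subtype_le p))) k
  have hk := hk.trans (Nat.mul_le_mul_left 12 (Nat.le_self_pow two_ne_zero _))
  calc 2 * ballBound {y // p y} k
      ≤ 2 * ballBound Y (12 * (N + κ + 1) ^ 2) :=
        Nat.mul_le_mul_left 2 (hsub.trans (ballBound_mono Y hk))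
    _ ≤ (κ + 1) * (2 * ballBound Y (12 * (N + κ + 1) ^ 2)) := Nat.le_mul_of_pos_left _ κ.succ_pos
    _ ≤ conjBound Y κ N := Nat.le_add_left _ _

lemma add_mul_ballBound_le_conjBound {Y : Type*} [Fintype Y] {k κ N : ℕ}
    (hk : k ≤ 12 * (N + κ + 1) ^ 2) : N + κ * (2 * ballBound Y k) ≤ conjBound Y κ N := by
  have hmono := ballBound_mono Y hk
  rw [conjBound]
  gcongr
  exact Nat.le_succ κ

open Syllables

section

variable {ι : Type*} {M : ι → Type*} [∀ i, Group (M i)] {H : Type*} [Group H] {θ : ∀ i, H →* M i}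

/-- Regularity of `u`, tested on the elements of `S` only: if `u` is elliptic, then it is conjugated
into the amalgamated subgroup only by elements of that subgroup, and if `u` is cyclically reduced
of length at least `2`, then it does not lie in the generalized normalizer. -/
def IsRegularOn (θ : ∀ i, H →* M i) (S : Set (PushoutI θ)) (u : PushoutI θ) : Prop :=
  u = 1 ∨
  ((factorSeq u).length ≤ 1 ∧
    ∀ z ∈ S, z⁻¹ * u * z ∈ (PushoutI.base θ).range → z ∈ (PushoutI.base θ).range) ∨
  ((factorSeq u).head? ≠ (factorSeq u).getLast? ∧
    ∀ z ∈ S, z ∈ (PushoutI.base θ).range → u⁻¹ * z * u ∈ (PushoutI.base θ).range → z = 1)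

lemma exists_mem_of_range_of_length_factorSeq_le (hθ : ∀ i, Function.Injective (θ i)) [Nonempty ι]
    {u : PushoutI θ} (hu : (factorSeq u).length ≤ 1) :
    ∃ i, u ∈ (PushoutI.of (φ := θ) i).range := by
  obtain ⟨c, l, hl, rfl⟩ := exists_reduced_form hθ u
  rw [hl.factorSeq_base_mul hθ, length_indices] at hu
  match l, hu with
  | [], _ =>
    exact ⟨Classical.arbitrary ι, by simpa using base_mem_of_range (Classical.arbitrary ι) c⟩
  | [⟨i, g⟩], _ => exact ⟨i, θ i c * g, by simp [PushoutI.of_apply_eq_base]⟩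

variable {Y : Type*} [DecidableEq Y] [Fintype Y] {side : Y → ι}
  {b : ∀ i, FreeGroupBasis {y // side y = i} (M i)}
  {ρ : Type*} [DecidableEq ρ] {β : FreeGroupBasis ρ H} {κ N : ℕ}

lemma of_mem_wordBall_conjBound {i : ι} {g : M i} [DecidablePred fun y => side y = i] {k : ℕ}
    (hk : k ≤ 12 * (N + κ + 1)) (hg : basisLength (b i) g ≤ 2 * ballBound {y // side y = i} k) :
    PushoutI.of i g ∈ wordBall (amalgamGen θ b) (conjBound Y κ N) :=
  wordBall_mono (hg.trans (two_mul_ballBound_subtype_le_conjBound _ hk)) (of_mem_wordBall g)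

theorem exists_mem_wordBall_conj_eq_of_elliptic [Nonempty ι] (hθ : ∀ i, Function.Injective (θ i))
    (hκ : ∀ i, IsQuasiconvexBound (b i) β (θ i) κ) {u v z : PushoutI θ}
    (hu : HasSize θ b u N) (hv : HasSize θ b v N) (hlen : (factorSeq u).length ≤ 1)
    (hreg : ∀ z ∈ wordBall (amalgamGen θ b) (conjBound Y κ N),
      z⁻¹ * u * z ∈ (PushoutI.base θ).range → z ∈ (PushoutI.base θ).range)
    (hcyc : CyclicallyAlternating (factorSeq v)) (hz : z⁻¹ * u * z = v) :
    ∃ w ∈ wordBall (amalgamGen θ b) (conjBound Y κ N), w⁻¹ * u * w = v := by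
  classical
  have hrange (i : ι) (a g : M i) (hag : PushoutI.of i a = u)
      (hg : (PushoutI.of i g)⁻¹ * PushoutI.of i a * PushoutI.of i g ∈ (PushoutI.base θ).range) :
      g ∈ (θ i).range := by
    subst hag
    have ha := hu.basisLength_le hθ
    refine (hκ i).mem_range_of_forall_short_conj_mem (u := a) (fun g hg hmem => ?_) ?_
    · refine (of_mem_base_range hθ).1 (hreg _ (of_mem_wordBall_conjBound (by omega) hg) ?_)
      rwa [← map_inv, ← map_mul, ← map_mul, of_mem_base_range hθ]
    · rwa [← map_inv, ← map_mul, ← map_mul, of_mem_base_range hθ] at hg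
  obtain ⟨i, hi⟩ := exists_mem_of_range_of_length_factorSeq_le hθ hlen
  obtain ⟨j, ⟨a, rfl⟩, ζ, rfl⟩ := exists_mem_factor_of_conj_elliptic hθ hi
    (fun j ⟨a, ha⟩ g hg => hrange j a g ha (ha ▸ hg)) (hz ▸ hcyc)
  subst hz
  rw [← map_inv, ← map_mul, ← map_mul] at hv ⊢
  have ha := hu.basisLength_le hθ
  have hconj := hv.basisLength_le hθ
  obtain ⟨ζ', heq, hle⟩ := exists_conj_eq_basisLength_le (b := b j) (u := a) (z := ζ) rfl
  refine ⟨PushoutI.of j ζ', of_mem_wordBall_conjBound (by omega) hle, ?_⟩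
  rw [← map_inv, ← map_mul, ← map_mul, heq]

end

variable {M : Bool → Type*} [∀ i, Group (M i)] {H : Type*} [Group H] {θ : ∀ i, H →* M i}
  {Y : Type*} [DecidableEq Y] [Fintype Y] {side : Y → Bool}
  {b : ∀ i, FreeGroupBasis {y // side y = i} (M i)}
  {ρ : Type*} [DecidableEq ρ] {β : FreeGroupBasis ρ H} {κ N : ℕ}

lemma head?_ne_getLast?_of_cyclicallyAlternating_conj (hθ : ∀ i, Function.Injective (θ i))
    {l : Syllables M} (hl : IsReduced θ l) (hends : l.indices.head? ≠ l.indices.getLast?)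
    {z : PushoutI θ} (hcyc : CyclicallyAlternating (factorSeq (z⁻¹ * prod θ l * z))) :
    (factorSeq (z⁻¹ * prod θ l * z)).head? ≠ (factorSeq (z⁻¹ * prod θ l * z)).getLast? := by
  obtain ⟨l₁, e, hrot, hl₁, heq⟩ := exists_isRotated_of_cyclicallyAlternating_conj hθ hl hends hcyc
  have hind : factorSeq (z⁻¹ * prod θ l * z) = l₁.indices := by
    rw [← heq, ← map_inv]
    exact hl₁.factorSeq_eq hθ _ _
  refine hcyc.resolve_left fun hle => hends ?_
  rw [hind, length_indices, ← hrot.perm.length_eq] at hle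
  match l, hle with
  | [], _ => rfl
  | [_], _ => rfl

lemma notMem_range_of_head?_ne_getLast? (hθ : ∀ i, Function.Injective (θ i)) {g : PushoutI θ}
    (hg : (factorSeq g).head? ≠ (factorSeq g).getLast?) : g ∉ (PushoutI.base θ).range := by
  rw [← factorSeq_eq_nil_iff hθ]
  intro h
  simp [h] at hg

theorem exists_mem_wordBall_conj_eq_of_hyperbolic (hθ : ∀ i, Function.Injective (θ i))
    (hκ : ∀ i, IsQuasiconvexBound (b i) β (θ i) κ) {u v z : PushoutI θ}
    (hu : HasSize θ b u N) (hv : HasSize θ b v N)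
    (hends : (factorSeq u).head? ≠ (factorSeq u).getLast?)
    (hreg : ∀ z ∈ wordBall (amalgamGen θ b) (conjBound Y κ N), z ∈ (PushoutI.base θ).range →
      u⁻¹ * z * u ∈ (PushoutI.base θ).range → z = 1)
    (hcyc : CyclicallyAlternating (factorSeq v)) (hz : z⁻¹ * u * z = v) :
    ∃ w ∈ wordBall (amalgamGen θ b) (conjBound Y κ N), w⁻¹ * u * w = v := by
  obtain ⟨lu, hlu, rfl, hNu⟩ := hu.exists_prod_eq (notMem_range_of_head?_ne_getLast? hθ hends)
  have hlen : lu.length * (κ + N) ≤ 12 * (N + κ + 1) ^ 2 := by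
    nlinarith [length_le_sylSize (b := b) lu]
  have hends' := hends
  rw [hlu.factorSeq_prod hθ] at hends'
  have hvends : (factorSeq v).head? ≠ (factorSeq v).getLast? := hz ▸
    head?_ne_getLast?_of_cyclicallyAlternating_conj hθ hlu hends' (hz.symm ▸ hcyc)
  obtain ⟨lv, hlv, rfl, hNv⟩ := hv.exists_prod_eq (notMem_range_of_head?_ne_getLast? hθ hvends)
  have hz' : z⁻¹⁻¹ * prod θ lv * z⁻¹ = prod θ lu := by simp [← hz, mul_assoc]
  rw [hlv.factorSeq_prod hθ] at hvends
  obtain ⟨l₁, e, hrot, hl₁, heq⟩ := exists_isRotated_of_cyclicallyAlternating_conj hθ hlv hvends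
    (hz'.symm ▸ Or.inr hends)
  rw [hz'] at heq
  have hle := basisLength_le_of_base_mul_prod_eq (c := e⁻¹) (e := e⁻¹) hθ hκ hlu hl₁
    (fun s hs => (basisLength_le_sylSize hs).trans hNu)
    (fun s hs => (basisLength_le_sylSize (hrot.mem_iff.2 hs)).trans hNv)
    (fun c d hc hcd => ?_) (by simp [← heq])
  · obtain ⟨w, hw, hconj⟩ := exists_mem_wordBall_conj_prod_eq_of_isRotated (θ := θ) (b := b) hrot
    refine ⟨PushoutI.base θ e⁻¹ * w⁻¹, wordBall_mono ?_ (mul_mem_wordBall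
      (base_mem_wordBall hκ false e⁻¹) (inv_mem_wordBall hw)), ?_⟩
    · have := Nat.mul_le_mul_left κ hle
      have := add_mul_ballBound_le_conjBound (Y := Y) hlen
      omega
    · simp only [← heq, ← hconj, map_inv]
      group
  · refine PushoutI.base_injective hθ ?_
    rw [map_one]
    refine hreg _ (wordBall_mono ?_ (base_mem_wordBall hκ false c)) ⟨c, rfl⟩ ⟨d, ?_⟩
    · exact (Nat.mul_le_mul_left κ hc).trans
        ((Nat.le_add_left _ N).trans (add_mul_ballBound_le_conjBound hlen))
    · rw [mul_assoc, hcd, inv_mul_cancel_left]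

theorem IsRegularOn.exists_mem_wordBall_conj_eq (hθ : ∀ i, Function.Injective (θ i))
    (hκ : ∀ i, IsQuasiconvexBound (b i) β (θ i) κ) {u v z : PushoutI θ}
    (hreg : IsRegularOn θ (wordBall (amalgamGen θ b) (conjBound Y κ N)) u)
    (hu : HasSize θ b u N) (hv : HasSize θ b v N)
    (hcyc : CyclicallyAlternating (factorSeq v)) (hz : z⁻¹ * u * z = v) :
    ∃ w ∈ wordBall (amalgamGen θ b) (conjBound Y κ N), w⁻¹ * u * w = v := by
  rcases hreg with rfl | ⟨hlen, hreg⟩ | ⟨hends, hreg⟩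
  · exact ⟨1, one_mem_wordBall _, by simpa using hz⟩
  · exact exists_mem_wordBall_conj_eq_of_elliptic hθ hκ hu hv hlen hreg hcyc hz
  · exact exists_mem_wordBall_conj_eq_of_hyperbolic hθ hκ hu hv hends hreg hcyc hz

end ConjugatorBound

section PrimrecWords

/-- The reduced word of the product of a letter and the element given by a reduced word. -/
def reducedCons {α : Type*} [DecidableEq α] (a : α × Bool) : List (α × Bool) → List (α × Bool)
  | [] => [a]
  | b :: w => if a.1 = b.1 ∧ a.2 = !b.2 then w else a :: b :: w

lemma foldr_reducedCons {α : Type*} [DecidableEq α] (w : List (α × Bool)) :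
    w.foldr reducedCons [] = FreeGroup.reduce w := by
  induction w with
  | nil => rfl
  | cons a w ih =>
    rw [List.foldr_cons, ih, FreeGroup.reduce.cons]
    cases FreeGroup.reduce w <;> rfl

variable {α : Type*} [Primcodable α]

lemma primrec₂_reducedCons [DecidableEq α] :
    Primrec₂ (reducedCons : α × Bool → List (α × Bool) → List (α × Bool)) := by
  have ha : Primrec fun p : ((α × Bool) × List (α × Bool)) × (α × Bool) × List (α × Bool) =>
    p.1.1 := Primrec.fst.comp Primrec.fst
  have hb : Primrec fun p : ((α × Bool) × List (α × Bool)) × (α × Bool) × List (α × Bool) =>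
    p.2.1 := Primrec.fst.comp Primrec.snd
  have hw : Primrec fun p : ((α × Bool) × List (α × Bool)) × (α × Bool) × List (α × Bool) =>
    p.2.2 := Primrec.snd.comp Primrec.snd
  have hcancel : PrimrecPred
      fun p : ((α × Bool) × List (α × Bool)) × (α × Bool) × List (α × Bool) =>
        p.1.1.1 = p.2.1.1 ∧ p.1.1.2 = !p.2.1.2 :=
    (Primrec.eq.comp (Primrec.fst.comp ha) (Primrec.fst.comp hb)).and
      (Primrec.eq.comp (Primrec.snd.comp ha) (Primrec.not.comp (Primrec.snd.comp hb)))
  refine (Primrec.list_casesOn Primrec.snd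
    (Primrec.list_cons.comp Primrec.fst (Primrec.const []))
    (Primrec.ite hcancel hw
      (Primrec.list_cons.comp ha (Primrec.list_cons.comp hb hw))).to₂).of_eq ?_
  rintro ⟨a, _ | ⟨b, w⟩⟩ <;> rfl

lemma primrecPred_mk_eq_one : PrimrecPred fun w : List (α × Bool) => FreeGroup.mk w = 1 := by
  classical
  have hreduce : Primrec (FreeGroup.reduce : List (α × Bool) → List (α × Bool)) :=
    (Primrec.list_foldr Primrec.id (Primrec.const [])
      (primrec₂_reducedCons.comp (Primrec.fst.comp Primrec.snd)
        (Primrec.snd.comp Primrec.snd)).to₂).of_eq foldr_reducedCons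
  refine (Primrec.eq.comp hreduce (Primrec.const [])).of_eq fun w => ?_
  rw [← FreeGroup.toWord_mk, FreeGroup.toWord_eq_nil_iff]

lemma primrec_invRev : Primrec (FreeGroup.invRev : List (α × Bool) → List (α × Bool)) :=
  Primrec.list_reverse.comp (Primrec.list_map Primrec.id
    (Primrec.pair (Primrec.fst.comp Primrec.snd) (Primrec.not.comp (Primrec.snd.comp Primrec.snd))))

lemma primrec_wordsLE (letters : List α) : Primrec (wordsLE letters) := by
  refine (Primrec.nat_rec₁ (f := fun _ r => [] :: r.flatMap fun w => letters.map (· :: w)) [[]]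
    ?_).of_eq fun k => ?_
  · exact Primrec.list_cons.comp (Primrec.const []) (Primrec.list_flatMap Primrec.snd
      (Primrec.list_map (Primrec.const letters)
        (Primrec.list_cons.comp Primrec.snd (Primrec.snd.comp Primrec.fst))))
  · induction k with
    | zero => rfl
    | succ k ih => simp only [wordsLE, ← ih]

lemma primrec_ballBound (Y : Type*) [Fintype Y] : Primrec (ballBound Y) := by
  refine (Primrec.nat_rec₁ (f := fun _ r => r * (2 * Fintype.card Y + 1)) 1
    (Primrec.nat_mul.comp Primrec.snd (Primrec.const _))).of_eq fun k => ?_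
  induction k with
  | zero => rfl
  | succ k ih => rw [ballBound, pow_succ, ← ballBound, ← ih]

lemma primrec_conjBound (Y : Type*) [Fintype Y] (κ : ℕ) : Primrec (conjBound Y κ) := by
  have hsum : Primrec fun N => N + κ + 1 :=
    Primrec.succ.comp (Primrec.nat_add.comp Primrec.id (Primrec.const κ))
  have hball : Primrec fun N => ballBound Y (12 * (N + κ + 1) ^ 2) :=
    ((primrec_ballBound Y).comp (Primrec.nat_mul.comp (Primrec.const 12)
      (Primrec.nat_mul.comp hsum hsum))).of_eq fun N => by rw [sq]
  exact Primrec.nat_add.comp Primrec.id (Primrec.nat_mul.comp (Primrec.const (κ + 1))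
    (Primrec.nat_mul.comp (Primrec.const 2) hball))

lemma primrecPred_forall_length_le {β : Type*} [Finite α] [Primcodable β]
    {R : List α → β → Prop} (hR : PrimrecRel R) {B : β → ℕ} (hB : Primrec B) :
    PrimrecPred fun x => ∀ w : List α, w.length ≤ B x → R w x := by
  cases nonempty_fintype α
  exact (hR.forall_mem_list.comp ((primrec_wordsLE (Finset.univ : Finset α).toList).comp hB)
    Primrec.id).of_eq fun b => by simp [mem_wordsLE]

end PrimrecWords

section NormalForm

open Syllables

variable {ι : Type*} {M : ι → Type*} [∀ i, Group (M i)] {H : Type*} [Group H]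
  {Y ρ : Type*} {side : Y → ι}

section

variable (b : ∀ i, FreeGroupBasis {y // side y = i} (M i)) (θ : ∀ i, H →* M i)
  (β : FreeGroupBasis ρ H)

open Classical in
/-- A word, in the basis of the factor `M i`, for the image of the element of the amalgamated
subgroup given by the word `z`. -/
noncomputable def baseWord (i : ι) (z : GroupWord ρ) : GroupWord Y :=
  z.flatMap fun a => factorWord b i (θ i (GroupWord.eval β [a]))

lemma primrec₂_baseWord [Primcodable ι] [Finite ι] [Primcodable Y] [Primcodable ρ] [Finite ρ] :
    Primrec₂ (baseWord b θ β) := by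
  classical
  exact Primrec.list_flatMap Primrec.snd
    ((Primrec.dom_finite fun p : ι × (ρ × Bool) =>
      factorWord b p.1 (θ p.1 (GroupWord.eval β [p.2]))).comp
        (Primrec.pair (Primrec.fst.comp Primrec.fst) Primrec.snd)).to₂

end

section

variable [DecidableEq ι]

/-- Remove the first syllable if it lies in the factor `M i`, and return a word for it. -/
def popFactor (i : ι) : List (ι × GroupWord Y) → GroupWord Y × List (ι × GroupWord Y)
  | [] => ([], [])
  | s :: l => if s.1 = i then (s.2, l) else ([], s :: l)

lemma primrec_popFactor [Primcodable ι] [Primcodable Y] : Primrec₂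
    (popFactor : ι → List (ι × GroupWord Y) → GroupWord Y × List (ι × GroupWord Y)) := by
  have hs : Primrec fun q : (ι × List (ι × GroupWord Y)) ×
    (ι × GroupWord Y) × List (ι × GroupWord Y) => q.2.1 := Primrec.fst.comp Primrec.snd
  have hl : Primrec fun q : (ι × List (ι × GroupWord Y)) ×
    (ι × GroupWord Y) × List (ι × GroupWord Y) => q.2.2 := Primrec.snd.comp Primrec.snd
  have htest : PrimrecPred fun q : (ι × List (ι × GroupWord Y)) ×
      (ι × GroupWord Y) × List (ι × GroupWord Y) => q.2.1.1 = q.1.1 :=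
    Primrec.eq.comp (Primrec.fst.comp hs) (Primrec.fst.comp Primrec.fst)
  refine (Primrec.list_casesOn Primrec.snd (Primrec.const ([], []))
    (Primrec.ite htest (Primrec.pair (Primrec.snd.comp hs) hl)
      (Primrec.pair (Primrec.const []) (Primrec.list_cons.comp hs hl))).to₂).of_eq ?_
  rintro ⟨i, _ | ⟨s, l⟩⟩ <;> rfl

section

variable (b : ∀ i, FreeGroupBasis {y // side y = i} (M i))

/-- The projection of the letters to the factor `M i`: the letters of the other factors become
trivial. -/
def factorGen (i : ι) (y : Y) : M i := if h : side y = i then b i ⟨y, h⟩ else 1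

lemma factorGen_coe {i : ι} (y : {y // side y = i}) : factorGen b i y = b i y :=
  dif_pos y.2

lemma map_repr_eval_factorGen (i : ι) (w : GroupWord Y) :
    FreeGroup.map Subtype.val ((b i).repr (GroupWord.eval (factorGen b i) w)) =
      FreeGroup.mk (w.filter fun x => side x.1 = i) := by
  induction w with
  | nil => simp [← FreeGroup.one_eq_mk]
  | cons x w ih =>
    rw [← List.singleton_append, GroupWord.eval_append, map_mul, map_mul, ih, List.filter_append,
      ← FreeGroup.mul_mk]
    congr 1
    obtain ⟨y, s⟩ := x
    by_cases hy : side y = i <;> cases s <;>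
      simp [GroupWord.eval, factorGen, hy, ← FreeGroup.one_eq_mk, FreeGroup.of, FreeGroup.inv_mk,
        FreeGroup.invRev]

lemma eval_factorGen_eq_one_iff (i : ι) (w : GroupWord Y) :
    GroupWord.eval (factorGen b i) w = 1 ↔ FreeGroup.mk (w.filter fun x => side x.1 = i) = 1 := by
  rw [← map_repr_eval_factorGen b, map_eq_one_iff _
    (FreeGroup.map_injective Subtype.val_injective), EmbeddingLike.map_eq_one_iff]

lemma primrecRel_eval_factorGen_eq_one [Primcodable ι] [Primcodable Y] [Finite Y] :
    PrimrecRel fun (i : ι) (w : GroupWord Y) => GroupWord.eval (factorGen b i) w = 1 := by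
  have hside : PrimrecRel fun (x : Y × Bool) (i : ι) => side x.1 = i :=
    Primrec.eq.comp₂ ((Primrec.dom_finite fun x : Y × Bool => side x.1).comp₂ Primrec₂.left)
      Primrec₂.right
  refine (primrecPred_mk_eq_one.comp (hside.listFilter.comp Primrec.snd Primrec.fst)).of_eq
    fun p => (eval_factorGen_eq_one_iff b p.1 p.2).symm

/-- The syllables represented by a list of words, each word being read in one of the factors. -/
def wordSyllables (l : List (ι × GroupWord Y)) : Syllables M :=
  l.map fun s => ⟨s.1, s.2.eval (factorGen b s.1)⟩

lemma indices_wordSyllables (l : List (ι × GroupWord Y)) :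
    (wordSyllables b l).indices = l.map Prod.fst := by
  simp [wordSyllables, indices, Function.comp_def]

variable (θ : ∀ i, H →* M i) (β : FreeGroupBasis ρ H)

/-- `s` is a reduced form of `g`, encoded by words: the first component stands for the coefficient
in the amalgamated subgroup, the second one lists the syllables with their factors. -/
def IsNormalForm (s : GroupWord ρ × List (ι × GroupWord Y)) (g : PushoutI θ) : Prop :=
  IsReduced θ (wordSyllables b s.2) ∧
    g = PushoutI.base θ (s.1.eval β) * prod θ (wordSyllables b s.2)

variable [Fintype ρ]

open Classical in
/-- A word for the element of the amalgamated subgroup whose image in `M i` is given by `w`. The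
search is confined to words of length at most `κ * w.length`. -/
noncomputable def findBase (κ : ℕ) (i : ι) (w : GroupWord Y) : Option (GroupWord ρ) :=
  ((wordsLE (Finset.univ : Finset (ρ × Bool)).toList (κ * w.length)).filter fun z =>
    θ i (GroupWord.eval β z) = GroupWord.eval (factorGen b i) w).head?

end

section

variable {θ : ∀ i, H →* M i} {b : ∀ i, FreeGroupBasis {y // side y = i} (M i)}
  {β : FreeGroupBasis ρ H} {κ : ℕ}

lemma IsNormalForm.factorSeq_eq (hθ : ∀ i, Function.Injective (θ i))
    {s : GroupWord ρ × List (ι × GroupWord Y)} {g : PushoutI θ} (h : IsNormalForm b θ β s g) :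
    factorSeq g = s.2.map Prod.fst := by
  rw [h.2, h.1.factorSeq_base_mul hθ, indices_wordSyllables]

lemma IsNormalForm.eq_one_iff (hθ : ∀ i, Function.Injective (θ i))
    {s : GroupWord ρ × List (ι × GroupWord Y)} {g : PushoutI θ} (h : IsNormalForm b θ β s g) :
    g = 1 ↔ factorSeq g = [] ∧ FreeGroup.mk s.1 = 1 := by
  rw [← repr_eval_basis β, EmbeddingLike.map_eq_one_iff]
  have hbase : factorSeq g = [] → g = PushoutI.base θ (s.1.eval β) := fun hnil => by
    rw [h.factorSeq_eq hθ, List.map_eq_nil_iff] at hnil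
    rw [h.2, hnil]
    simp [wordSyllables]
  constructor
  · intro hg
    have hnil : factorSeq g = [] := (factorSeq_eq_nil_iff hθ).2 (hg ▸ one_mem _)
    exact ⟨hnil, (map_eq_one_iff _ (PushoutI.base_injective hθ)).1 ((hbase hnil).symm.trans hg)⟩
  · rintro ⟨hnil, hone⟩
    rw [hbase hnil, hone, map_one]

lemma of_mul_prod_popFactor (i : ι) (l : List (ι × GroupWord Y)) :
    PushoutI.of i (GroupWord.eval (factorGen b i) (popFactor i l).1) *
      prod θ (wordSyllables b (popFactor i l).2) = prod θ (wordSyllables b l) := by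
  rcases l with _ | ⟨⟨j, w⟩, l⟩
  · simp [popFactor]
  · by_cases hj : j = i
    · subst hj
      simp [popFactor, wordSyllables]
    · simp [popFactor, hj]

lemma isReduced_popFactor (i : ι) {l : List (ι × GroupWord Y)}
    (hl : IsReduced θ (wordSyllables b l)) :
    IsReduced θ (wordSyllables b (popFactor i l).2) ∧
      ∀ j ∈ ((popFactor i l).2.map Prod.fst).head?, i ≠ j := by
  rcases l with _ | ⟨⟨j, w⟩, l⟩
  · exact ⟨hl, by simp [popFactor]⟩
  · by_cases hj : j = i
    · subst hj
      have htail := (isReduced_cons_iff.1 hl).2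
      rw [← wordSyllables, indices_wordSyllables] at htail
      simpa only [popFactor, if_true] using htail
    · simp only [popFactor, hj, if_false]
      exact ⟨hl, by simpa [eq_comm] using hj⟩

lemma map_eval_of_findBase_eq_some [Fintype ρ] {i : ι} {w : GroupWord Y} {z : GroupWord ρ}
    (h : findBase b θ β κ i w = some z) :
    θ i (GroupWord.eval β z) = GroupWord.eval (factorGen b i) w := by
  simpa using (List.mem_filter.1 (List.mem_of_head? h)).2

end

section

variable [DecidableEq Y]

lemma eval_factorWord_factorGen (b : ∀ i, FreeGroupBasis {y // side y = i} (M i)) (i : ι)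
    (g : M i) : (factorWord b i g).eval (factorGen b i) = g :=
  eval_factorWord g (MonoidHom.id (M i)) (factorGen_coe b)

lemma basisLength_eval_factorGen_le (b : ∀ i, FreeGroupBasis {y // side y = i} (M i))
    (i : ι) (w : GroupWord Y) :
    basisLength (b i) (GroupWord.eval (factorGen b i) w) ≤ w.length := by
  induction w with
  | nil => simp [basisLength]
  | cons x w ih =>
    have hletter : basisLength (b i) (GroupWord.eval (factorGen b i) [x]) ≤ 1 := by
      obtain ⟨y, s⟩ := x
      by_cases hy : side y = i <;> cases s <;> simp [GroupWord.eval, factorGen, hy, basisLength]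
    have hmul := basisLength_mul_le (b i) (GroupWord.eval (factorGen b i) [x])
      (GroupWord.eval (factorGen b i) w)
    rw [← GroupWord.eval_append, List.singleton_append] at hmul
    rw [List.length_cons]
    omega

lemma sylSize_wordSyllables_le (b : ∀ i, FreeGroupBasis {y // side y = i} (M i))
    (l : List (ι × GroupWord Y)) :
    sylSize b (wordSyllables b l) ≤ (l.flatMap Prod.snd).length + l.length := by
  induction l with
  | nil => simp [wordSyllables, sylSize]
  | cons s l ih =>
    have hs := basisLength_eval_factorGen_le b s.1 s.2
    simp only [wordSyllables, List.map_cons, sylSize_cons, List.flatMap_cons, List.length_append,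
      List.length_cons] at ih ⊢
    omega

end

section

variable (b : ∀ i, FreeGroupBasis {y // side y = i} (M i)) (θ : ∀ i, H →* M i)
  (β : FreeGroupBasis ρ H)

lemma eval_baseWord (i : ι) (z : GroupWord ρ) :
    (baseWord b θ β i z).eval (factorGen b i) = θ i (GroupWord.eval β z) := by
  classical
  induction z with
  | nil => simp [baseWord]
  | cons a z ih =>
    rw [baseWord, List.flatMap_cons, ← baseWord, GroupWord.eval_append, ih,
      eval_factorWord_factorGen, ← map_mul, ← GroupWord.eval_append, List.singleton_append]

variable [Fintype ρ]

/-- The normal form of the product of the element of `M i` given by `w` and the reduced product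
given by `l`, which must not start in `M i`. -/
noncomputable def pushFactor (κ : ℕ) (i : ι) (w : GroupWord Y) (l : List (ι × GroupWord Y)) :
    GroupWord ρ × List (ι × GroupWord Y) :=
  (findBase b θ β κ i w).elim ([], (i, w) :: l) (·, l)

/-- The normal form of the product of a letter and the element with normal form `s`. -/
noncomputable def letterMul (κ : ℕ) (x : Y × Bool) (s : GroupWord ρ × List (ι × GroupWord Y)) :
    GroupWord ρ × List (ι × GroupWord Y) :=
  pushFactor b θ β κ (side x.1)
    (x :: (baseWord b θ β (side x.1) s.1 ++ (popFactor (side x.1) s.2).1))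
    (popFactor (side x.1) s.2).2

/-- A normal form of the element given by a word: a word for its coefficient in the amalgamated
subgroup and words for its syllables. -/
noncomputable def normalForm (κ : ℕ) (w : GroupWord Y) : GroupWord ρ × List (ι × GroupWord Y) :=
  w.foldr (letterMul b θ β κ) ([], [])

end

variable {θ : ∀ i, H →* M i} {b : ∀ i, FreeGroupBasis {y // side y = i} (M i)}
  {β : FreeGroupBasis ρ H} {κ : ℕ}

section

variable [DecidableEq Y] [DecidableEq ρ]

lemma IsNormalForm.hasSize (hκ : ∀ i, IsQuasiconvexBound (b i) β (θ i) κ)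
    {s : GroupWord ρ × List (ι × GroupWord Y)} {g : PushoutI θ} (h : IsNormalForm b θ β s g) :
    HasSize θ b g (κ * s.1.length + ((s.2.flatMap Prod.snd).length + s.2.length)) :=
  ⟨s.1.eval β, _, h.1, h.2, fun i => Nat.add_le_add (((hκ i).length_map_le _).trans
    (Nat.mul_le_mul_left _ (basisLength_eval_le β _))) (sylSize_wordSyllables_le b _)⟩

variable [Fintype ρ]

lemma notMem_range_of_findBase_eq_none (hκ : ∀ i, IsQuasiconvexBound (b i) β (θ i) κ) {i : ι}
    {w : GroupWord Y} (h : findBase b θ β κ i w = none) :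
    GroupWord.eval (factorGen b i) w ∉ (θ i).range := by
  rintro ⟨c, hc⟩
  rw [findBase, List.head?_eq_none_iff, List.filter_eq_nil_iff] at h
  refine h (β.repr c).toWord ((mem_wordsLE (by simp)).2 ?_) (by simpa [eval_toWord_repr])
  calc basisLength β c ≤ κ * basisLength (b i) (θ i c) := (hκ i).length_le_map c
    _ ≤ κ * w.length := by
      rw [hc]
      exact Nat.mul_le_mul_left κ (basisLength_eval_factorGen_le b i w)

lemma isNormalForm_pushFactor (hκ : ∀ i, IsQuasiconvexBound (b i) β (θ i) κ) {i : ι}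
    (w : GroupWord Y) {l : List (ι × GroupWord Y)} (hl : IsReduced θ (wordSyllables b l))
    (hi : ∀ j ∈ (l.map Prod.fst).head?, i ≠ j) :
    IsNormalForm b θ β (pushFactor b θ β κ i w l)
      (PushoutI.of i (GroupWord.eval (factorGen b i) w) * prod θ (wordSyllables b l)) := by
  rw [pushFactor]
  cases h : findBase b θ β κ i w with
  | some z =>
    refine ⟨hl, ?_⟩
    rw [← map_eval_of_findBase_eq_some h, PushoutI.of_apply_eq_base]
    rfl
  | none =>
    refine ⟨isReduced_cons_iff.2 ⟨notMem_range_of_findBase_eq_none hκ h, hl, ?_⟩, ?_⟩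
    · rwa [← wordSyllables, indices_wordSyllables]
    · simp [wordSyllables]

lemma IsNormalForm.letterMul (hκ : ∀ i, IsQuasiconvexBound (b i) β (θ i) κ) (x : Y × Bool)
    {s : GroupWord ρ × List (ι × GroupWord Y)} {g : PushoutI θ} (h : IsNormalForm b θ β s g) :
    IsNormalForm b θ β (letterMul b θ β κ x s) (GroupWord.eval (amalgamGen θ b) [x] * g) := by
  have hx : GroupWord.eval (amalgamGen θ b) [x] =
      PushoutI.of (side x.1) (GroupWord.eval (factorGen b (side x.1)) [x]) := by
    obtain ⟨y, _ | _⟩ := x <;> simp [GroupWord.eval, amalgamGen, factorGen]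
  have hprod : GroupWord.eval (amalgamGen θ b) [x] * g =
      PushoutI.of (side x.1) (GroupWord.eval (factorGen b (side x.1))
        (x :: (baseWord b θ β (side x.1) s.1 ++ (popFactor (side x.1) s.2).1))) *
        prod θ (wordSyllables b (popFactor (side x.1) s.2).2) := by
    rw [← List.singleton_append (l := baseWord b θ β _ s.1 ++ _), GroupWord.eval_append,
      GroupWord.eval_append, eval_baseWord,
      map_mul, map_mul, PushoutI.of_apply_eq_base, mul_assoc, mul_assoc, of_mul_prod_popFactor,
      ← h.2, hx]
  obtain ⟨hl, hi⟩ := isReduced_popFactor (side x.1) h.1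
  rw [hprod]
  exact isNormalForm_pushFactor hκ _ hl hi

theorem isNormalForm_normalForm (hκ : ∀ i, IsQuasiconvexBound (b i) β (θ i) κ)
    (w : GroupWord Y) :
    IsNormalForm b θ β (normalForm b θ β κ w) (GroupWord.eval (amalgamGen θ b) w) := by
  induction w with
  | nil => exact ⟨isReduced_nil, by simp [normalForm, wordSyllables]⟩
  | cons x w ih =>
    rw [← List.singleton_append, GroupWord.eval_append]
    exact ih.letterMul hκ x

end

section

variable [Primcodable ι] [Finite ι] [Primcodable Y] [Finite Y]

variable [Primcodable ρ] [Fintype ρ] (b : ∀ i, FreeGroupBasis {y // side y = i} (M i))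
  (θ : ∀ i, H →* M i) (β : FreeGroupBasis ρ H) (κ : ℕ)

lemma primrec₂_findBase : Primrec₂ (findBase b θ β κ) := by
  have htest : PrimrecRel fun (z : GroupWord ρ) (p : ι × GroupWord Y) =>
      GroupWord.eval (factorGen b p.1) (p.2 ++ FreeGroup.invRev (baseWord b θ β p.1 z)) = 1 :=
    (primrecRel_eval_factorGen_eq_one b).comp (Primrec.fst.comp Primrec.snd)
      (Primrec.list_append.comp (Primrec.snd.comp Primrec.snd) (primrec_invRev.comp
        ((primrec₂_baseWord b θ β).comp (Primrec.fst.comp Primrec.snd) Primrec.fst)))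
  have hwords : Primrec fun p : ι × GroupWord Y =>
      wordsLE (Finset.univ : Finset (ρ × Bool)).toList (κ * p.2.length) :=
    (primrec_wordsLE _).comp (Primrec.nat_mul.comp (Primrec.const κ)
      (Primrec.list_length.comp Primrec.snd))
  classical
  refine (Primrec.list_head?.comp (htest.listFilter.comp hwords Primrec.id)).of_eq fun p => ?_
  simp only [findBase, id, GroupWord.eval_append, GroupWord.eval_invRev, eval_baseWord,
    mul_inv_eq_one]
  simp only [eq_comm]

lemma primrec_pushFactor : Primrec fun p : ι × GroupWord Y × List (ι × GroupWord Y) =>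
    pushFactor b θ β κ p.1 p.2.1 p.2.2 := by
  have hw : Primrec fun p : ι × GroupWord Y × List (ι × GroupWord Y) => p.2.1 :=
    Primrec.fst.comp Primrec.snd
  have hl : Primrec fun p : ι × GroupWord Y × List (ι × GroupWord Y) => p.2.2 :=
    Primrec.snd.comp Primrec.snd
  refine (Primrec.option_casesOn ((primrec₂_findBase b θ β κ).comp Primrec.fst hw)
    (Primrec.pair (Primrec.const []) (Primrec.list_cons.comp (Primrec.pair Primrec.fst hw) hl))
    (Primrec.pair Primrec.snd (hl.comp Primrec.fst)).to₂).of_eq fun p => ?_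
  rw [pushFactor]
  cases findBase b θ β κ p.1 p.2.1 <;> rfl

lemma primrec₂_letterMul : Primrec₂ (letterMul b θ β κ) := by
  have hi : Primrec fun p : (Y × Bool) × GroupWord ρ × List (ι × GroupWord Y) => side p.1.1 :=
    (Primrec.dom_finite fun x : Y × Bool => side x.1).comp Primrec.fst
  have hpop : Primrec fun p : (Y × Bool) × GroupWord ρ × List (ι × GroupWord Y) =>
      popFactor (side p.1.1) p.2.2 := primrec_popFactor.comp hi (Primrec.snd.comp Primrec.snd)
  have hbase : Primrec fun p : (Y × Bool) × GroupWord ρ × List (ι × GroupWord Y) =>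
      baseWord b θ β (side p.1.1) p.2.1 :=
    (primrec₂_baseWord b θ β).comp hi (Primrec.fst.comp Primrec.snd)
  exact (primrec_pushFactor b θ β κ).comp (Primrec.pair hi (Primrec.pair
    (Primrec.list_cons.comp Primrec.fst (Primrec.list_append.comp hbase (Primrec.fst.comp hpop)))
    (Primrec.snd.comp hpop)))

lemma primrec_normalForm : Primrec (normalForm b θ β κ) :=
  Primrec.list_foldr Primrec.id (Primrec.const ([], []))
    ((primrec₂_letterMul b θ β κ).comp (Primrec.fst.comp Primrec.snd)
      (Primrec.snd.comp Primrec.snd)).to₂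

end

end

section

variable {θ : ∀ i, H →* M i} {b : ∀ i, FreeGroupBasis {y // side y = i} (M i)}
  {β : FreeGroupBasis ρ H} {κ : ℕ} [Primcodable ι] [Finite ι] [Primcodable Y] [Finite Y]
  [Primcodable ρ] [Finite ρ] [DecidableEq Y] [DecidableEq ρ]

theorem primrec_factorSeq_eval (hθ : ∀ i, Function.Injective (θ i))
    (hκ : ∀ i, IsQuasiconvexBound (b i) β (θ i) κ) :
    Primrec fun w : GroupWord Y => factorSeq (GroupWord.eval (amalgamGen θ b) w) := by
  classical
  cases nonempty_fintype ρ
  exact (Primrec.list_map (Primrec.snd.comp (primrec_normalForm b θ β κ))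
    (Primrec.fst.comp Primrec.snd).to₂).of_eq
      fun w => ((isNormalForm_normalForm hκ w).factorSeq_eq hθ).symm

theorem primrecPred_eval_eq_one (hθ : ∀ i, Function.Injective (θ i))
    (hκ : ∀ i, IsQuasiconvexBound (b i) β (θ i) κ) :
    PrimrecPred fun w : GroupWord Y => GroupWord.eval (amalgamGen θ b) w = 1 := by
  classical
  cases nonempty_fintype ρ
  exact ((Primrec.eq.comp (primrec_factorSeq_eval hθ hκ) (Primrec.const [])).and
    (primrecPred_mk_eq_one.comp (Primrec.fst.comp (primrec_normalForm b θ β κ)))).of_eq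
      fun w => ((isNormalForm_normalForm hκ w).eq_one_iff hθ).symm

theorem exists_primrec_hasSize_eval (hκ : ∀ i, IsQuasiconvexBound (b i) β (θ i) κ) :
    ∃ σ : GroupWord Y → ℕ, Primrec σ ∧
      ∀ w, HasSize θ b (GroupWord.eval (amalgamGen θ b) w) (σ w) := by
  classical
  cases nonempty_fintype ρ
  refine ⟨_, ?_, fun w => (isNormalForm_normalForm hκ w).hasSize hκ⟩
  have hcoeff := Primrec.fst.comp (primrec_normalForm b θ β κ)
  have hsyl := Primrec.snd.comp (primrec_normalForm b θ β κ)
  exact Primrec.nat_add.comp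
    (Primrec.nat_mul.comp (Primrec.const κ) (Primrec.list_length.comp hcoeff))
    (Primrec.nat_add.comp (Primrec.list_length.comp
      (Primrec.list_flatMap hsyl (Primrec.snd.comp Primrec.snd).to₂))
      (Primrec.list_length.comp hsyl))

end

end NormalForm

section ConjugacySearch

/-- The word `z⁻¹ u z`. -/
def conjWord {X : Type*} (z u : GroupWord X) : GroupWord X := FreeGroup.invRev z ++ u ++ z

@[simp] lemma eval_conjWord {X G : Type*} [Group G] (γ : X → G) (z u : GroupWord X) :
    (conjWord z u).eval γ = (z.eval γ)⁻¹ * u.eval γ * z.eval γ := by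
  simp [conjWord, mul_assoc]

lemma primrec₂_conjWord {X : Type*} [Primcodable X] :
    Primrec₂ (conjWord : GroupWord X → GroupWord X → GroupWord X) :=
  Primrec.list_append.comp (Primrec.list_append.comp (primrec_invRev.comp Primrec.fst)
    Primrec.snd) Primrec.fst

lemma primrecPred_imp {α : Type*} [Primcodable α] {p q : α → Prop} (hp : PrimrecPred p)
    (hq : PrimrecPred q) : PrimrecPred fun a => p a → q a :=
  (hp.not.or hq).of_eq fun _ => imp_iff_not_or.symm

lemma forall_mem_wordBall {X G : Type*} [Group G] {γ : X → G} {N : ℕ} {p : G → Prop} :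
    (∀ g ∈ wordBall γ N, p g) ↔ ∀ w : GroupWord X, w.length ≤ N → p (w.eval γ) := by
  simp [wordBall]

lemma isConj_conj_iff {G : Type*} [Group G] (s t g h : G) :
    IsConj (s⁻¹ * g * s) (t⁻¹ * h * t) ↔ IsConj g h := by
  have hconj (r x : G) : IsConj x (r⁻¹ * x * r) := isConj_iff.2 ⟨r⁻¹, by simp⟩
  exact ⟨fun hst => ((hconj s g).trans hst).trans (hconj t h).symm,
    fun hgh => ((hconj s g).symm.trans hgh).trans (hconj t h)⟩

section

variable {X : Type*} [Primcodable X] {G : Type*} [Group G]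

open Classical in
/-- The `k`-th step of the search: `k` encodes a pair of words `(s, t)`. The answer is `s` if `s`
conjugates `u` to `v`, and it is `none` (not conjugate) if `R` certifies this once `u` and `v` have
been conjugated by `s` and `t`. -/
noncomputable def conjSearchStep (γ : X → G) (R : GroupWord X → GroupWord X → Prop)
    (p : GroupWord X × GroupWord X) (k : ℕ) : Option (Option (GroupWord X)) :=
  (Encodable.decode k : Option (GroupWord X × GroupWord X)).bind fun q =>
    if GroupWord.eval γ (conjWord q.1 p.1) = GroupWord.eval γ p.2 then some (some q.1)
    else if R (conjWord q.1 p.1) (conjWord q.2 p.2) then some none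
    else none

variable {γ : X → G} {R : GroupWord X → GroupWord X → Prop}

lemma primrec₂_conjSearchStep (heq : PrimrecRel fun u v => GroupWord.eval γ u = GroupWord.eval γ v)
    (hR : PrimrecRel R) : Primrec₂ (conjSearchStep γ R) := by
  have hu : Primrec fun x : ((GroupWord X × GroupWord X) × ℕ) × (GroupWord X × GroupWord X) =>
      conjWord x.2.1 x.1.1.1 :=
    primrec₂_conjWord.comp (Primrec.fst.comp Primrec.snd)
      (Primrec.fst.comp (Primrec.fst.comp Primrec.fst))
  have hv : Primrec fun x : ((GroupWord X × GroupWord X) × ℕ) × (GroupWord X × GroupWord X) =>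
      x.1.1.2 := Primrec.snd.comp (Primrec.fst.comp Primrec.fst)
  classical
  exact Primrec.option_bind (Primrec.decode.comp Primrec.snd)
    (Primrec.ite (heq.comp hu hv)
      (Primrec.option_some.comp (Primrec.option_some.comp (Primrec.fst.comp Primrec.snd)))
      (Primrec.ite (hR.comp hu (primrec₂_conjWord.comp (Primrec.snd.comp Primrec.snd) hv))
        (Primrec.const (some none)) (Primrec.const none))).to₂

lemma isConjSearchAnswer_of_mem_conjSearchStep
    (hnot : ∀ u v, R u v → ¬ IsConj (GroupWord.eval γ u) (GroupWord.eval γ v))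
    {u v : GroupWord X} {k : ℕ} {r : Option (GroupWord X)}
    (hr : r ∈ conjSearchStep γ R (u, v) k) : IsConjSearchAnswer γ u v r := by
  obtain ⟨⟨s, t⟩, -, hst⟩ := Option.bind_eq_some_iff.1 hr
  split_ifs at hst with hconj hcert
  · cases hst
    rwa [eval_conjWord] at hconj
  · cases hst
    have := hnot _ _ hcert
    rwa [eval_conjWord, eval_conjWord, isConj_conj_iff] at this

theorem conjSearchDecidableOn_of_certificate (hγ : ∀ g, ∃ w, GroupWord.eval γ w = g)
    (heq : PrimrecRel fun u v => GroupWord.eval γ u = GroupWord.eval γ v) (hR : PrimrecRel R)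
    (hnot : ∀ u v, R u v → ¬ IsConj (GroupWord.eval γ u) (GroupWord.eval γ v)) {Φ : Set (G × G)}
    (hcert : ∀ u v, (GroupWord.eval γ u, GroupWord.eval γ v) ∈ Φ →
      ¬ IsConj (GroupWord.eval γ u) (GroupWord.eval γ v) →
        ∃ s t, R (conjWord s u) (conjWord t v)) :
    ConjSearchDecidableOn γ Φ := by
  refine ⟨_, Partrec.rfindOpt (primrec₂_conjSearchStep heq hR).to_comp, fun u v r hr => ?_,
    fun u v huv => Nat.rfindOpt_dom.2 ?_⟩
  · obtain ⟨k, hk⟩ := Nat.rfindOpt_spec hr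
    exact isConjSearchAnswer_of_mem_conjSearchStep hnot hk
  · by_cases hconj : IsConj (GroupWord.eval γ u) (GroupWord.eval γ v)
    · obtain ⟨c, hc⟩ := isConj_iff.1 hconj
      obtain ⟨s, hs⟩ := hγ c⁻¹
      exact ⟨Encodable.encode (s, s), some s, by simp [conjSearchStep, hs, hc]⟩
    · obtain ⟨s, t, hst⟩ := hcert u v huv hconj
      have hs : (GroupWord.eval γ s)⁻¹ * GroupWord.eval γ u * GroupWord.eval γ s ≠
          GroupWord.eval γ v := fun h =>
        hconj (isConj_iff.2 ⟨(GroupWord.eval γ s)⁻¹, by rw [inv_inv, h]⟩)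
      exact ⟨Encodable.encode (s, t), none, by simp [conjSearchStep, hs, hst]⟩

end

open Syllables

lemma primrecPred_head?_ne_getLast? {α : Type*} [Primcodable α] :
    PrimrecPred fun l : List α => l.head? ≠ l.getLast? :=
  (Primrec.eq.comp Primrec.list_head? ((Primrec.list_head?.comp Primrec.list_reverse).of_eq
    fun _ => List.head?_reverse)).not

lemma primrecPred_cyclicallyAlternating {α : Type*} [Primcodable α] :
    PrimrecPred (CyclicallyAlternating : List α → Prop) :=
  (Primrec.nat_le.comp Primrec.list_length (Primrec.const 1)).or primrecPred_head?_ne_getLast?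

variable {ι : Type*} {M : ι → Type*} [∀ i, Group (M i)] {H : Type*} [Group H] {Y ρ : Type*}
  {side : Y → ι} {θ : ∀ i, H →* M i} {b : ∀ i, FreeGroupBasis {y // side y = i} (M i)}
  {β : FreeGroupBasis ρ H} {κ : ℕ}

lemma IsRegularOn.mono {S T : Set (PushoutI θ)} {u : PushoutI θ} (h : IsRegularOn θ T u)
    (hST : S ⊆ T) : IsRegularOn θ S u :=
  h.imp id (Or.imp (And.imp_right fun hz z hzS => hz z (hST hzS))
    (And.imp_right fun hz z hzS => hz z (hST hzS)))

lemma exists_eval_amalgamGen_eq [Nonempty ι] (g : PushoutI θ) :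
    ∃ w, GroupWord.eval (amalgamGen θ b) w = g := by
  classical
  have hof (i : ι) (a : M i) : ∃ w, GroupWord.eval (amalgamGen θ b) w = PushoutI.of i a :=
    (of_mem_wordBall a).imp fun _ hw => hw.2
  induction g using PushoutI.induction_on with
  | of i a => exact hof i a
  | base c =>
    rw [← PushoutI.of_apply_eq_base θ (Classical.arbitrary ι)]
    exact hof _ _
  | mul g h hg hh =>
    obtain ⟨w, rfl⟩ := hg
    obtain ⟨w', rfl⟩ := hh
    exact ⟨w ++ w', by simp⟩

section

variable [DecidableEq Y]

lemma HasSize.mono {g : PushoutI θ} {N N' : ℕ} (h : HasSize θ b g N) (hle : N ≤ N') :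
    HasSize θ b g N' := by
  obtain ⟨c, l, hl, hg, hN⟩ := h
  exact ⟨c, l, hl, hg, fun i => (hN i).trans hle⟩

variable [DecidableEq ρ] [Primcodable ι] [Finite ι] [Primcodable Y] [Primcodable ρ] [Finite ρ]

section

variable [Finite Y]

lemma primrecRel_eval_eq (hθ : ∀ i, Function.Injective (θ i))
    (hκ : ∀ i, IsQuasiconvexBound (b i) β (θ i) κ) :
    PrimrecRel fun u v : GroupWord Y =>
      GroupWord.eval (amalgamGen θ b) u = GroupWord.eval (amalgamGen θ b) v := by
  refine ((primrecPred_eval_eq_one hθ hκ).comp (Primrec.list_append.comp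
    (primrec_invRev.comp Primrec.fst) Primrec.snd)).of_eq fun p => ?_
  rw [GroupWord.eval_append, GroupWord.eval_invRev, inv_mul_eq_one]

lemma primrecRel_isRegularOn_wordBall (hθ : ∀ i, Function.Injective (θ i))
    (hκ : ∀ i, IsQuasiconvexBound (b i) β (θ i) κ) :
    PrimrecRel fun (k : ℕ) (u : GroupWord Y) =>
      IsRegularOn θ (wordBall (amalgamGen θ b) k) (GroupWord.eval (amalgamGen θ b) u) := by
  have hseq := primrec_factorSeq_eval hθ hκ
  have hone := primrecPred_eval_eq_one hθ hκ
  have hmem : PrimrecPred fun w : GroupWord Y =>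
      GroupWord.eval (amalgamGen θ b) w ∈ (PushoutI.base θ).range :=
    (Primrec.eq.comp hseq (Primrec.const [])).of_eq fun _ => factorSeq_eq_nil_iff hθ
  have hz : Primrec fun q : GroupWord Y × ℕ × GroupWord Y => q.1 := Primrec.fst
  have hu : Primrec fun q : GroupWord Y × ℕ × GroupWord Y => q.2.2 := Primrec.snd.comp Primrec.snd
  have helliptic : PrimrecRel fun (z : GroupWord Y) (p : ℕ × GroupWord Y) =>
      GroupWord.eval (amalgamGen θ b) (conjWord z p.2) ∈ (PushoutI.base θ).range →
        GroupWord.eval (amalgamGen θ b) z ∈ (PushoutI.base θ).range :=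
    primrecPred_imp (hmem.comp (primrec₂_conjWord.comp hz hu)) (hmem.comp hz)
  have hhyperbolic : PrimrecRel fun (z : GroupWord Y) (p : ℕ × GroupWord Y) =>
      GroupWord.eval (amalgamGen θ b) z ∈ (PushoutI.base θ).range →
        GroupWord.eval (amalgamGen θ b) (conjWord p.2 z) ∈ (PushoutI.base θ).range →
          GroupWord.eval (amalgamGen θ b) z = 1 :=
    primrecPred_imp (hmem.comp hz) (primrecPred_imp (hmem.comp (primrec₂_conjWord.comp hu hz))
      (hone.comp hz))
  have hseq' := hseq.comp (Primrec.snd (α := ℕ) (β := GroupWord Y))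
  refine ((hone.comp Primrec.snd).or
    (((Primrec.nat_le.comp (Primrec.list_length.comp hseq') (Primrec.const 1)).and
      (primrecPred_forall_length_le helliptic Primrec.fst)).or
    ((primrecPred_head?_ne_getLast?.comp hseq').and
      (primrecPred_forall_length_le hhyperbolic Primrec.fst)))).of_eq fun p => ?_
  simp only [IsRegularOn, forall_mem_wordBall, eval_conjWord]

end

end

section

variable {M : Bool → Type*} [∀ i, Group (M i)] {θ : ∀ i, H →* M i} {side : Y → Bool}
  {b : ∀ i, FreeGroupBasis {y // side y = i} (M i)} [DecidableEq Y] [DecidableEq ρ]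

section

variable [Fintype Y]

/-- A decidable condition, in which only finitely many conjugators of `u` are tested, under which
the elements `u` and `v`, of size at most `N`, are not conjugate. -/
def NonConjCertificate (θ : ∀ i, H →* M i) (b : ∀ i, FreeGroupBasis {y // side y = i} (M i))
    (κ N : ℕ) (u v : PushoutI θ) : Prop :=
  CyclicallyAlternating (factorSeq v) ∧
    (∀ z ∈ wordBall (amalgamGen θ b) (conjBound Y κ N), z⁻¹ * u * z ≠ v) ∧
    IsRegularOn θ (wordBall (amalgamGen θ b) (conjBound Y κ N)) u

lemma NonConjCertificate.not_isConj (hθ : ∀ i, Function.Injective (θ i))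
    (hκ : ∀ i, IsQuasiconvexBound (b i) β (θ i) κ) {N : ℕ} {u v : PushoutI θ}
    (h : NonConjCertificate θ b κ N u v) (hu : HasSize θ b u N) (hv : HasSize θ b v N) :
    ¬ IsConj u v := by
  intro hconj
  obtain ⟨c, hc⟩ := isConj_iff.1 hconj
  obtain ⟨hcyc, hne, hreg⟩ := h
  obtain ⟨w, hw, heq⟩ := hreg.exists_mem_wordBall_conj_eq hθ hκ hu hv hcyc
    (z := c⁻¹) (by simpa using hc)
  exact hne w hw heq

lemma primrecRel_nonConjCertificate [Primcodable Y] [Primcodable ρ] [Finite ρ]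
    (hθ : ∀ i, Function.Injective (θ i)) (hκ : ∀ i, IsQuasiconvexBound (b i) β (θ i) κ)
    {σ : GroupWord Y → ℕ} (hσ : Primrec σ) :
    PrimrecRel fun u v => NonConjCertificate θ b κ (σ u + σ v)
      (GroupWord.eval (amalgamGen θ b) u) (GroupWord.eval (amalgamGen θ b) v) := by
  have hB : Primrec fun p : GroupWord Y × GroupWord Y => conjBound Y κ (σ p.1 + σ p.2) :=
    (primrec_conjBound Y κ).comp
      (Primrec.nat_add.comp (hσ.comp Primrec.fst) (hσ.comp Primrec.snd))
  have hne : PrimrecRel fun (z : GroupWord Y) (p : GroupWord Y × GroupWord Y) =>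
      GroupWord.eval (amalgamGen θ b) (conjWord z p.1) ≠ GroupWord.eval (amalgamGen θ b) p.2 :=
    ((primrecRel_eval_eq hθ hκ).comp (primrec₂_conjWord.comp Primrec.fst
      (Primrec.fst.comp Primrec.snd)) (Primrec.snd.comp Primrec.snd)).not
  refine ((primrecPred_cyclicallyAlternating.comp
    ((primrec_factorSeq_eval hθ hκ).comp Primrec.snd)).and
    ((primrecPred_forall_length_le hne hB).and
      ((primrecRel_isRegularOn_wordBall hθ hκ).comp hB Primrec.fst))).of_eq fun p => ?_
  simp only [NonConjCertificate, forall_mem_wordBall, eval_conjWord]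

end

theorem conjSearchDecidableOn_isRegularOn [Primcodable Y] [Finite Y] [Finite ρ]
    (hθ : ∀ i, Function.Injective (θ i)) (hκ : ∀ i, IsQuasiconvexBound (b i) β (θ i) κ) :
    ConjSearchDecidableOn (amalgamGen θ b)
      ({u | ∃ g, IsRegularOn θ Set.univ g ∧ IsConj g u} ×ˢ Set.univ) := by
  cases nonempty_fintype Y
  obtain ⟨r, ⟨e⟩⟩ := Finite.exists_equiv_fin ρ
  let _ : Primcodable ρ := Primcodable.ofEquiv (Fin r) e
  obtain ⟨σ, hσ, hsize⟩ := exists_primrec_hasSize_eval hκ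
  refine conjSearchDecidableOn_of_certificate exists_eval_amalgamGen_eq (primrecRel_eval_eq hθ hκ)
    (primrecRel_nonConjCertificate hθ hκ hσ) (fun u v hcert => hcert.not_isConj hθ hκ
      ((hsize u).mono (Nat.le_add_right _ _)) ((hsize v).mono (Nat.le_add_left _ _)))
    fun u v huv hconj => ?_
  obtain ⟨⟨g, hreg, hgu⟩, -⟩ := huv
  obtain ⟨c, hc⟩ : ∃ c, c * g * c⁻¹ = GroupWord.eval (amalgamGen θ b) u := isConj_iff.1 hgu
  obtain ⟨s, hs⟩ := exists_eval_amalgamGen_eq (b := b) c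
  obtain ⟨z, hz⟩ := exists_conj_cyclicallyAlternating hθ (GroupWord.eval (amalgamGen θ b) v)
  obtain ⟨t, rfl⟩ := exists_eval_amalgamGen_eq (b := b) z
  have hg : (GroupWord.eval (amalgamGen θ b) s)⁻¹ * GroupWord.eval (amalgamGen θ b) u *
      GroupWord.eval (amalgamGen θ b) s = g := by
    rw [hs, ← hc]
    group
  refine ⟨s, t, by rwa [eval_conjWord], fun w _ hw => ?_, ?_⟩
  · refine hconj ((isConj_conj_iff (GroupWord.eval (amalgamGen θ b) s)
      (GroupWord.eval (amalgamGen θ b) t) _ _).1 (isConj_iff.2 ⟨w⁻¹, ?_⟩))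
    simpa using hw
  · rw [eval_conjWord, hg]
    exact hreg.mono (Set.subset_univ _)

end

end ConjugacySearch

section Corollary

lemma conj_mem_conjSubgroup {G : Type*} [Group G] {K : Subgroup G} {x : G} (hx : x ∈ K) (g : G) :
    g⁻¹ * x * g ∈ conjSubgroup K g :=
  ⟨x, hx, by simp⟩

lemma mem_genNormalizer_of_conj_mem {G : Type*} [Group G] {K : Subgroup G} {x g : G} (hx : x ∈ K)
    (h1 : x ≠ 1) (hg : g⁻¹ * x * g ∈ K) : g ∈ genNormalizer K := by
  intro hbot
  have hmem : g⁻¹ * x * g ∈ K ⊓ conjSubgroup K g := ⟨hg, conj_mem_conjSubgroup hx g⟩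
  rw [hbot, Subgroup.mem_bot, mul_eq_one_iff_eq_inv, inv_mul_eq_iff_eq_mul, mul_inv_cancel] at hmem
  exact h1 hmem

lemma IsRegularElt.mem_of_conj_mem {G : Type*} [Group G] {K : Subgroup G} {u : G}
    (h : IsRegularElt K u) (hu : u ∈ K) (h1 : u ≠ 1) {g : G} (hg : g⁻¹ * u * g ∈ K) : g ∈ K := by
  by_contra hgK
  exact h (Or.inr (Set.mem_iUnion₂.2 ⟨g, ⟨mem_genNormalizer_of_conj_mem hu h1 hg, hgK⟩, hu, hg⟩))

lemma IsRegularElt.eq_one_of_conj_mem {G : Type*} [Group G] {K : Subgroup G} {u : G}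
    (h : IsRegularElt K u) (hu : u ∉ K) {g : G} (hg : g ∈ K) (hg' : u⁻¹ * g * u ∈ K) : g = 1 := by
  by_contra h1
  exact h (Or.inl ⟨mem_genNormalizer_of_conj_mem hg h1 hg', hu⟩)

variable {A B : Type u} {C : Type v} [Group A] [Group B] [Group C] {φ : C →* A} {ψ : C →* B}

lemma factorHom_injective (hφ : Function.Injective φ) (hψ : Function.Injective ψ) :
    ∀ i, Function.Injective (factorHom φ ψ i)
  | false => hφ
  | true => hψ

lemma Amalgam.IsReducedForm.factorSeq_eq {g : Amalgam φ ψ} {c : C} {w : CoprodI.Word (Factor A B)}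
    (h : Amalgam.IsReducedForm φ ψ g c w) (hφ : Function.Injective φ)
    (hψ : Function.Injective ψ) : factorSeq g = Syllables.indices w.toList := by
  have hprod : PushoutI.ofCoprodI w.prod = Syllables.prod (factorHom φ ψ) w.toList := by
    simp [Syllables.prod, CoprodI.Word.prod, map_list_prod, Function.comp_def]
  have hred : Syllables.IsReduced (factorHom φ ψ) w.toList :=
    ⟨fun s hs => h.1 s hs, by simpa [Syllables.indices, List.isChain_map] using w.chain_ne⟩
  rw [h.2, hprod, hred.factorSeq_base_mul (factorHom_injective hφ hψ)]

theorem Amalgam.IsCyclicallyReduced.isRegularOn {g : Amalgam φ ψ}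
    (hg : Amalgam.IsCyclicallyReduced φ ψ g) (hreg : IsRegularElt (Amalgam.amalgamated φ ψ) g)
    (hφ : Function.Injective φ) (hψ : Function.Injective ψ) :
    IsRegularOn (factorHom φ ψ) Set.univ g := by
  obtain ⟨c, w, hform, hcyc⟩ := hg
  have hseq := hform.factorSeq_eq hφ hψ
  have hlen : (factorSeq g).length = w.toList.length := by rw [hseq, Syllables.length_indices]
  have hmem := Syllables.factorSeq_eq_nil_iff (factorHom_injective hφ hψ) (g := g)
  rw [← List.length_eq_zero_iff, hlen] at hmem
  rcases hcyc with h0 | ⟨h1, hnc⟩ | ⟨h2, s, hs, t, ht, hst⟩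
  · by_cases hone : g = 1
    · exact .inl hone
    · exact .inr (.inl ⟨by omega, fun z _ hz => hreg.mem_of_conj_mem (hmem.1 h0) hone hz⟩)
  · exact .inr (.inl ⟨by omega, fun z _ hz =>
      absurd (isConj_iff.2 ⟨z⁻¹, by simp⟩) (hnc (z⁻¹ * g * z) hz)⟩)
  · refine .inr (.inr ⟨?_, fun z _ hz hz' => hreg.eq_one_of_conj_mem (fun hg => ?_) hz hz'⟩)
    · rw [hseq, Syllables.indices, List.head?_map, List.getLast?_map, hs, ht]
      simpa using hst
    · have := hmem.2 hg
      omega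

lemma ConjSearchDecidableOn.mono {X : Type*} [Primcodable X] {G : Type*} [Group G] {γ : X → G}
    {Φ Φ' : Set (G × G)} (h : ConjSearchDecidableOn γ Φ') (hΦ : Φ ⊆ Φ') :
    ConjSearchDecidableOn γ Φ :=
  let ⟨f, hf, hans, hdom⟩ := h
  ⟨f, hf, hans, fun u v huv => hdom u v (hΦ huv)⟩

/-- The standard bases `X` and `Y` of the two factors, each indexed by the letters of `X ⊕ Y` that
lie in it. -/
noncomputable def factorBasis (X Y : Type u) :
    ∀ i, FreeGroupBasis {y : X ⊕ Y // y.isRight = i} (Factor (FreeGroup X) (FreeGroup Y) i)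
  | false => (FreeGroupBasis.ofFreeGroup X).reindex
      ((Equiv.subtypeEquivRight fun _ => by simp).trans Equiv.sumIsLeft).symm
  | true => (FreeGroupBasis.ofFreeGroup Y).reindex Equiv.sumIsRight.symm

lemma amalgamGen_factorBasis {X Y : Type u} (φ : C →* FreeGroup X) (ψ : C →* FreeGroup Y) :
    amalgamGen (factorHom φ ψ) (factorBasis X Y) = Amalgam.gen φ ψ := by
  funext y
  cases y with
  | inl x => exact congrArg (PushoutI.of false) <|
      (FreeGroupBasis.reindex_apply _ _ _).trans (FreeGroupBasis.ofFreeGroup_apply _)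
  | inr y => exact congrArg (PushoutI.of true) <|
      (FreeGroupBasis.reindex_apply _ _ _).trans (FreeGroupBasis.ofFreeGroup_apply _)

end Corollary

theorem corollary4p19 (m n : ℕ) (C : Type v) [Group C] [Group.FG C]
    (φ : C →* FreeGroup (Fin m)) (ψ : C →* FreeGroup (Fin n))
    (hφ : Function.Injective φ) (hψ : Function.Injective ψ) :
    ConjSearchDecidableOn (Amalgam.gen φ ψ) (Amalgam.CR φ ψ ×ˢ (Set.univ : Set (Amalgam φ ψ))) := by
  obtain ⟨r, ⟨β⟩⟩ := exists_freeGroupBasis_fin_of_injective hφ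
  have hθ := factorHom_injective hφ hψ
  choose κ hκ using fun i =>
    exists_isQuasiconvexBound (b := factorBasis (Fin m) (Fin n) i) (β := β) (hθ i)
  rw [← amalgamGen_factorBasis]
  refine (conjSearchDecidableOn_isRegularOn hθ (κ := max (κ false) (κ true)) fun i =>
    (hκ i).mono (by cases i <;> simp)).mono (Set.prod_mono_left ?_)
  rintro u ⟨g, hg, hreg, hgu⟩
  exact ⟨g, hg.isRegularOn hreg hφ hψ, hgu⟩
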